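/- **Setting.** Let $\mathcal G=(\mathcal V,\mathcal E)$ be a digraph with $N$ nodes ($e_{ij}\in\mathcal E$ means that $i$ receives the pulses of $j$; $\mathcal N_i^+$ is the set of in-neighbours of $i$ and $d_i=|\mathcal N_i^+|$). Let $\mathcal R\subseteq\mathcal V$ be the set of normal oscillators, $R=|\mathcal R|$; the others are misbehaving. Let $f\ge 0$ be an integer and $\alpha>0$. Each normal oscillator $i$ has a phase $\phi_i$ that grows at the rate of its frequency $\omega_i>0$, a flag $\gamma_i$, a counter $c_i$, a multiset $\mathcal F_i$ and corrections $\bar z_i,\underline z_i$, with $\gamma_i=c_i=\bar z_i=\underline z_i=0$, $\mathcal F_i=\varnothing$ at time $0$, and runs the following algorithm. 1. When $\phi_i$ reaches $1$, oscillator $i$ sets $\gamma_i=1$, resets $\phi_i$ to $0$ and emits a pulse that carries its frequency to its out-neighbours. 2. When $i$ receives a pulse, it adds the received frequency to $\mathcal F_i$ and increases $c_i$ by $1$. If $c_i$ becomes $f+1$, it sets $\bar z_i=1-\phi_i$ if $\phi_i\in[0.5,1)$ and $\bar z_i=0$ otherwise. If $c_i$ becomes $d_i-f$, it sets $\underline z_i=-\phi_i$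 if $\phi_i\in[0,0.5)$ and $\underline z_i=0$ otherwise. 3. When $\phi_i=0.5$ and $\gamma_i=1$: if $c_i>d_i$, an attack is detected and $\phi_i,\omega_i$ stay unchanged. If $c_i\le d_i$, then $\phi_i$ is increased by $(\bar z_i+\underline z_i)/2$, the $f_i$ largest and the $f_i$ smallest elements of $\mathcal F_i$ are removed, where $f_i=f-(d_i-c_i)$, and $\omega_i$ is replaced by a convex combination of $\omega_i$ and the remaining values in which all weights are at least $\alpha$ (the weights may vary from update to update). In both cases $i$ then resets $\gamma_i=0$, $c_i=0$, $\mathcal F_i=\varnothing$. Misbehaving oscillators emit pulses at arbitrary instants and report arbitrary frequencies. The events (a normal oscillator fires; a normal oscillator updates; a misbehaving oscillator emits a pulse that at least one normal oscillator receives) form an infinite sequence at times $0=t_0\le t_1\le t_2\le\cdots$, where $t_0$ is the initial time and simultaneous events are counted separately; $k$ refers to the instant right after the $k$-th event. The attack is *stealthy* if no normal oscillator ever has $c_i>d_i$, that is, none of them ever detects an attack. The digraph is *$r$-robust* if for any two disjoint nonempty proper subsets $\mathcal V_1,\mathcal V_2$ of $\mathcal V$, some node of $\mathcal V_1$ has at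 least $r$ in-neighbours outside $\mathcal V_1$, or some node of $\mathcal V_2$ has at least $r$ in-neighbours outside $\mathcal V_2$. Let $\Delta$ be the length of the shortest arc of the circle $\mathbb R/\mathbb Z$ that contains the phases of all normal oscillators. For an integer $\bar k\ge1$ let $\delta(k)$ be the maximum minus the minimum of all $\omega_i(l)$ with $i\in\mathcal R$ and $k-\bar k+1\le l\le k$, where $\omega_i(l)=\omega_i(0)$ for $l<0$; thus $\delta(0)=\max_{i\in\mathcal R}\omega_i(0)-\min_{i\in\mathcal R}\omega_i(0)$. **Theorem 1.** Assume that $|\mathcal N_i^+\setminus\mathcal R|\le f$ for every $i\in\mathcal R$ ($f$-local attack), that $\mathcal G$ is $(2f+1)$-robust, that $\phi_i(0)\in[0,0.5)$ and $\omega_i(0)\ge1$ for every $i\in\mathcal R$, and that $$\Delta(0)+\frac{4NR}{\alpha^{2NR}}\,\delta(0)<0.5 .$$ If the attack is stealthy, then the frequencies and the phases of the normal oscillators synchronize exponentially. Precisely: 1. $t_k\to\infty$, and there is an integer $\bar k$ with $1\le\bar k\le 3N^2$ such that every normal oscillator makes at least one update among any $\bar k$ consecutive events. 2. For every $\bar k\ge1$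 with this update property and every $k\ge0$, $$\delta(k)\le\Bigl(1-\frac{\alpha^{\bar kR}}2\Bigr)^{\lfloor k/(\bar kR)\rfloor}\delta(0),$$ and $\delta(k)\to0$ as $k\to\infty$. 3. $\Delta(k)\to0$ as $k\to\infty$, and $\Delta(k)\le C\rho^k$ for all $k$, with some $C$ and some $\rho\in(0,1)$. 4. In continuous time, there are $C$ and $c>0$ such that at every time $s\ge0$ both $\Delta$ and the current frequency spread $\max_{i\in\mathcal R}\omega_i-\min_{i\in\mathcal R}\omega_i$ are at most $Ce^{-cs}$. -/

import Mathlib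

open Filter Topology

/-- `r`-robustness of a directed graph. Here `G.Adj i j` means that `i` receives information
directly from `j`, that is, `j` is an in-neighbour of `i`. -/
def IsRobust {V : Type*} (G : Digraph V) (r : ℕ) : Prop :=
  ∀ V₁ V₂ : Set V, V₁.Nonempty → V₂.Nonempty → V₁ ⊂ Set.univ → V₂ ⊂ Set.univ → Disjoint V₁ V₂ →
    (∃ i ∈ V₁, r ≤ {j | G.Adj i j ∧ j ∉ V₁}.ncard) ∨
    (∃ i ∈ V₂, r ≤ {j | G.Adj i j ∧ j ∉ V₂}.ncard)

/-- The in-degree `dᵢ`: the number of in-neighbours of `i`. -/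
noncomputable def inDegree {V : Type*} (G : Digraph V) (i : V) : ℕ :=
  {j | G.Adj i j}.ncard

/-- The `f`-local attack model: every normal oscillator has at most `f` misbehaving in-neighbours.
The misbehaving oscillators are those outside `normal`. -/
def IsLocalAttack {V : Type*} (G : Digraph V) (normal : Finset V) (f : ℕ) : Prop :=
  ∀ i ∈ normal, {j | G.Adj i j ∧ j ∉ normal}.ncard ≤ f

/-- The variables of all oscillators at one instant. The entries of misbehaving oscillators
carry no meaning and influence nothing. -/
structure OscState (V : Type*) where
  /-- the phase `φᵢ` -/
  phase : V → ℝ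
  /-- the absolute frequency `ωᵢ` -/
  freq : V → ℝ
  /-- the flag `γᵢ` (`true` after firing, `false` after updating) -/
  flag : V → Bool
  /-- the counter `cᵢ` of the pulses received in the current round -/
  count : V → ℕ
  /-- the collection `𝓕ᵢ` of the frequencies received in the current round, with multiplicity -/
  vals : V → Multiset ℝ
  /-- the stored forward correction `z̄ᵢ ≥ 0` -/
  zUp : V → ℝ
  /-- the stored backward correction `z̲ᵢ ≤ 0` -/
  zLow : V → ℝ

/-- The events: a normal oscillator fires, a normal oscillator performs its update, or a
misbehaving oscillator `j` emits a pulse, reporting to each receiver `i` an arbitrary frequency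
`v i`. -/
inductive OscEvent (V : Type*) where
  | fire (i : V) : OscEvent V
  | update (i : V) : OscEvent V
  | attack (j : V) (v : V → ℝ) : OscEvent V

namespace OscState

variable {V : Type*}

/-- Free evolution during a time `τ`: every phase grows at the rate of its frequency. -/
def flow (S : OscState V) (τ : ℝ) : OscState V :=
  { S with phase := fun i => S.phase i + τ * S.freq i }

open Classical in
/-- Reaction of the out-neighbours `i` of `j` to a pulse of `j` that carries the frequency `v i`:
the frequency is stored and the counter increased; if the counter becomes `f + 1`, the forward
correction is set; if the counter becomes `dᵢ - f`, the backward correction is set. -/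
noncomputable def receive (G : Digraph V) (f : ℕ) (S : OscState V) (j : V) (v : V → ℝ) :
    OscState V where
  phase := S.phase
  freq := S.freq
  flag := S.flag
  count := fun i => if G.Adj i j then S.count i + 1 else S.count i
  vals := fun i => if G.Adj i j then v i ::ₘ S.vals i else S.vals i
  zUp := fun i =>
    if G.Adj i j ∧ S.count i + 1 = f + 1 then
      (if 1 / 2 ≤ S.phase i ∧ S.phase i < 1 then 1 - S.phase i else 0)
    else S.zUp i
  zLow := fun i =>
    if G.Adj i j ∧ S.count i + 1 + f = inDegree G i then
      (if 0 ≤ S.phase i ∧ S.phase i < 1 / 2 then - S.phase i else 0)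
    else S.zLow i

open Classical in
/-- Oscillator `i` fires: it raises its flag, resets its phase to `0`, and its pulse, together
with its absolute frequency, reaches its out-neighbours. -/
noncomputable def fire (G : Digraph V) (f : ℕ) (S : OscState V) (i : V) : OscState V :=
  receive G f
    { S with phase := Function.update S.phase i 0, flag := Function.update S.flag i true }
    i (fun _ => S.freq i)

/-- The values that remain of `F` after removal of its `m` largest and its `m` smallest elements
(in increasing order, with multiplicity). -/
noncomputable def trimmed (F : Multiset ℝ) (m : ℕ) : List ℝ :=
  ((F.sort (· ≤ ·)).drop m).take (Multiset.card F - 2 * m)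

/-- The values `𝓙ᵢ` used by oscillator `i`: the received frequencies without the `fᵢ` largest
and the `fᵢ` smallest ones, where `fᵢ = f - (dᵢ - cᵢ)`. -/
noncomputable def retained (G : Digraph V) (f : ℕ) (S : OscState V) (i : V) : List ℝ :=
  trimmed (S.vals i) (f + S.count i - inDegree G i)

/-- `w` is an admissible new frequency of oscillator `i`: a convex combination of its own
frequency and the retained values, all of whose weights are at least `α`. -/
def IsNewFreq (G : Digraph V) (f : ℕ) (α : ℝ) (S : OscState V) (i : V) (w : ℝ) : Prop :=
  ∃ (a₀ : ℝ) (a : Fin (retained G f S i).length → ℝ),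
    α ≤ a₀ ∧ (∀ m, α ≤ a m) ∧ a₀ + ∑ m, a m = 1 ∧
      w = a₀ * S.freq i + ∑ m, a m * (retained G f S i).get m

open Classical in
/-- Oscillator `i` gets the phase `p` and the frequency `w`, and resets its flag, its counter and
its collection of received frequencies. -/
noncomputable def reset (S : OscState V) (i : V) (p w : ℝ) : OscState V :=
  { S with
    phase := Function.update S.phase i p
    freq := Function.update S.freq i w
    flag := Function.update S.flag i false
    count := Function.update S.count i 0
    vals := Function.update S.vals i 0 }

/-- The update of oscillator `i` turns `S` into `S'`. If more than `dᵢ` pulses were counted, an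
attack is detected, and neither phase nor frequency changes; otherwise both are updated. -/
def IsUpdate (G : Digraph V) (f : ℕ) (α : ℝ) (S : OscState V) (i : V) (S' : OscState V) : Prop :=
  (inDegree G i < S.count i ∧ S' = reset S i (S.phase i) (S.freq i)) ∨
  (S.count i ≤ inDegree G i ∧ ∃ w, IsNewFreq G f α S i w ∧
    S' = reset S i (S.phase i + (S.zUp i + S.zLow i) / 2) w)

/-- The free evolution during `τ` does not miss an action of a normal oscillator: no phase runs
beyond `1`, and no phase with raised flag runs beyond `1 / 2`. -/
def CanFlow (normal : Finset V) (S : OscState V) (τ : ℝ) : Prop :=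
  0 ≤ τ ∧ ∀ i ∈ normal, S.phase i + τ * S.freq i ≤ 1 ∧
    (S.flag i = true → S.phase i ≤ 1 / 2 → S.phase i + τ * S.freq i ≤ 1 / 2)

/-- `S'` is a possible result of the event `e` in the state `S`. Pulses of misbehaving
oscillators that no normal oscillator can receive have no effect and are not regarded as
events. -/
def IsEvent (G : Digraph V) (normal : Finset V) (f : ℕ) (α : ℝ) (S : OscState V) :
    OscEvent V → OscState V → Prop
  | .fire i, S' => i ∈ normal ∧ S.phase i = 1 ∧ S' = fire G f S i
  | .update i, S' => i ∈ normal ∧ S.phase i = 1 / 2 ∧ S.flag i = true ∧ IsUpdate G f α S i S'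
  | .attack j v, S' => j ∉ normal ∧ (∃ i ∈ normal, G.Adj i j) ∧ S' = receive G f S j v

/-- The length of the shortest arc of the circle `ℝ / ℤ` that contains the phases of all normal
oscillators. -/
noncomputable def arc (normal : Finset V) (S : OscState V) : ℝ :=
  sInf {L : ℝ | 0 ≤ L ∧ ∃ a : ℝ, ∀ i ∈ normal, ∃ m : ℤ, S.phase i + m ∈ Set.Icc a (a + L)}

/-- The largest frequency of a normal oscillator. -/
noncomputable def maxFreq (normal : Finset V) (S : OscState V) : ℝ :=
  ⨆ i : normal, S.freq i

/-- The smallest frequency of a normal oscillator. -/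
noncomputable def minFreq (normal : Finset V) (S : OscState V) : ℝ :=
  ⨅ i : normal, S.freq i

end OscState

/-- A sequence of events with the states between them: `event k` happens at time `time (k + 1)`,
and `state (k + 1)` is the state right after it. -/
structure Execution (V : Type*) where
  /-- the event times, with initial time `time 0` -/
  time : ℕ → ℝ
  /-- the states right after the events, with initial state `state 0` -/
  state : ℕ → OscState V
  /-- the events -/
  event : ℕ → OscEvent V

namespace Execution

variable {V : Type*}

/-- All normal oscillators run the resilient synchronization algorithm based on absolute
frequencies, with parameters `f` and `α`, while the others misbehave arbitrarily. -/
structure IsRun (G : Digraph V) (normal : Finset V) (f : ℕ) (α : ℝ) (X : Execution V) : Prop where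
  time_zero : X.time 0 = 0
  flag_zero : ∀ i ∈ normal, (X.state 0).flag i = false
  count_zero : ∀ i ∈ normal, (X.state 0).count i = 0
  vals_zero : ∀ i ∈ normal, (X.state 0).vals i = 0
  zUp_zero : ∀ i ∈ normal, (X.state 0).zUp i = 0
  zLow_zero : ∀ i ∈ normal, (X.state 0).zLow i = 0
  canFlow : ∀ k, (X.state k).CanFlow normal (X.time (k + 1) - X.time k)
  isEvent : ∀ k, ((X.state k).flow (X.time (k + 1) - X.time k)).IsEvent G normal f α
    (X.event k) (X.state (k + 1))

/-- The attack is stealthy: no normal oscillator ever counts more than `dᵢ` pulses within one of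
its rounds, so no attack is ever detected. -/
def IsStealthy (G : Digraph V) (normal : Finset V) (X : Execution V) : Prop :=
  ∀ k, ∀ i ∈ normal, (X.state k).count i ≤ inDegree G i

/-- Among any `K` consecutive events, every normal oscillator makes at least one update. -/
def UpdatesWithin (normal : Finset V) (X : Execution V) (K : ℕ) : Prop :=
  ∀ k, ∀ i ∈ normal, ∃ l < K, X.event (k + l) = OscEvent.update i

/-- `M_ω(k)`, the largest normal frequency at the instants `k - K + 1, …, k`; instants before `0`
are read as `0`. -/
noncomputable def windowMax (normal : Finset V) (X : Execution V) (K k : ℕ) : ℝ :=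
  ⨆ l : Fin K, (X.state (k - l)).maxFreq normal

/-- `m_ω(k)`, the smallest normal frequency at the instants `k - K + 1, …, k`; instants before `0`
are read as `0`. -/
noncomputable def windowMin (normal : Finset V) (X : Execution V) (K k : ℕ) : ℝ :=
  ⨅ l : Fin K, (X.state (k - l)).minFreq normal

/-- The frequency spread `δ(k) = M_ω(k) - m_ω(k)` with window length `K`. -/
noncomputable def spread (normal : Finset V) (X : Execution V) (K k : ℕ) : ℝ :=
  X.windowMax normal K k - X.windowMin normal K k

/-- The length `Δ(k)` of the normal containing arc right after the `k`-th event. -/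
noncomputable def arc (normal : Finset V) (X : Execution V) (k : ℕ) : ℝ :=
  (X.state k).arc normal

end Execution

/-! The run is read round by round instead of event by event. Let `w q i` be the frequency of `i`
after its `q`-th update and `τ q i` the time at which it fires next. While the normal phases, lifted
to the real line, stay less than half a turn apart, rounds do not mix: every normal oscillator fires
before any of them updates, and all have updated before one fires again
(`Timing.fires_eq_of_update`, `Timing.round_eq_of_fire`). An update therefore sees exactly one pulse
of each normal in-neighbour, all from the same round, and asynchrony disappears.

Stealthiness bounds the number of false pulses in a round by the number of values trimmed at each
end. Hence `w (q + 1)` arises from `w q` by a synchronous resilient consensus step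
(`IsNewFreq.consensusStep`). The two phase corrections compare the firing time of `i` with two order
statistics of the pulses it hears, so the firing times also make a consensus step, with weight `1 /
2` (`Pulses.consensusStep`), up to a common shift and an error of the order of the frequency width
(`time_step`).

On a `(2f+1)`-robust digraph such steps contract the hull of the normal values
(`consensus_contraction`): in each step a node leaves the set of high nodes or the set of low nodes.
So the frequency width decays geometrically in the number of rounds, and so does the width of the
firing times, which it drives (`exists_round_bound`).

The argument looks circular, since the half-turn bound is needed for the rounds and the rounds for
the contraction. `Invariant` closes the circle by induction over the events: the phases lie in an
envelope that widens only through frequency differences, at a total cost bounded by the summed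
frequency widths of the rounds reached so far, a geometric sum that the initial condition keeps
below `1 / 2`.

Finally rounds are converted into events and time. The counter `load` shows that boundedly many
events fit between two updates (`updatesWithin`), and `lift_mem` makes rounds and elapsed time
proportional. -/

/-! ### Resilient consensus steps and their contraction on robust digraphs. -/

/-- One step of resilient consensus, seen from node `i`: the new value `y` of `i` lies, up to the
error `e`, in the hull of the old normal values `v`, and moves away from an end of the hull if
`i` or sufficiently many of its in-neighbours are away from that end. -/
def ConsensusStep {V : Type*} (G : Digraph V) (N : Finset V) (f : ℕ) (β e : ℝ) (v : V → ℝ) (i : V)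
    (y : ℝ) : Prop :=
  (∀ M ε, 0 ≤ ε → (∀ j ∈ N, v j ≤ M) →
    -- Misbehaving in-neighbours count as away from the end: robustness counts all in-neighbours
    -- outside a set of normal nodes. `M` may be any upper bound, not only the maximum.
    (v i ≤ M - ε ∨ 2 * f + 1 ≤ {j | G.Adj i j ∧ (j ∈ N → v j ≤ M - ε)}.ncard) →
      y ≤ M - β * ε + e) ∧
  (∀ m ε, 0 ≤ ε → (∀ j ∈ N, m ≤ v j) →
    (m + ε ≤ v i ∨ 2 * f + 1 ≤ {j | G.Adj i j ∧ (j ∈ N → m + ε ≤ v j)}.ncard) →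
      m + β * ε - e ≤ y)

namespace ConsensusStep

variable {V : Type*} {G : Digraph V} {N : Finset V} {f : ℕ} {β e : ℝ} {v : V → ℝ} {i : V} {y : ℝ}

theorem le_of_bound (h : ConsensusStep G N f β e v i y) (hi : i ∈ N) {M : ℝ}
    (hM : ∀ j ∈ N, v j ≤ M) : y ≤ M + e := by
  have := h.1 M 0 le_rfl hM (Or.inl (by simpa using hM i hi))
  simpa using this

theorem ge_of_bound (h : ConsensusStep G N f β e v i y) (hi : i ∈ N) {m : ℝ}
    (hm : ∀ j ∈ N, m ≤ v j) : m - e ≤ y := by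
  have := h.2 m 0 le_rfl hm (Or.inl (by simpa using hm i hi))
  simpa using this

theorem perturb (h : ConsensusStep G N f β 0 v i y) {z : ℝ} (hz : |z - y| ≤ e) :
    ConsensusStep G N f β e v i z := by
  have hz' := abs_le.1 hz
  refine ⟨fun M ε hε hM h' => ?_, fun m ε hε hm h' => ?_⟩
  · have := h.1 M ε hε hM h'
    linarith [hz'.2]
  · have := h.2 m ε hε hm h'
    linarith [hz'.1]

theorem mono (h : ConsensusStep G N f β e v i y) {e' : ℝ} (he : e ≤ e') :
    ConsensusStep G N f β e' v i y :=
  ⟨fun M ε hε hM h' => by linarith [h.1 M ε hε hM h'],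
    fun m ε hε hm h' => by linarith [h.2 m ε hε hm h']⟩

end ConsensusStep

open Classical in
/-- On an `(2f+1)`-robust digraph, `n` consensus steps contract the hull of the normal values if
there are at most `n + 1` normal nodes. -/
theorem consensus_contraction {V : Type*} {G : Digraph V} {N : Finset V} {f : ℕ}
    (hrobust : IsRobust G (2 * f + 1)) {β e : ℝ} (hβ : 0 < β) (hβ1 : β ≤ 1) (he : 0 ≤ e)
    {v : ℕ → V → ℝ} {c : ℕ → ℝ} {n : ℕ}
    (hstep : ∀ q < n, ∀ i ∈ N, ConsensusStep G N f β e (v q) i (v (q + 1) i - c q))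
    {M m : ℝ} (hM : ∀ i ∈ N, v 0 i ≤ M) (hm : ∀ i ∈ N, m ≤ v 0 i) (hmM : m ≤ M)
    (hn : N.card ≤ n + 1) :
    ∃ M' m', (∀ i ∈ N, v n i ≤ M') ∧ (∀ i ∈ N, m' ≤ v n i) ∧
      M' - m' ≤ (1 - β ^ n / 2) * (M - m) + 2 * n * e := by
  -- `M'` and `m'` absorb only the drift `c` and the error `e`, never the progress. Progress is
  -- measured by the nodes within `β ^ q * ((M - m) / 2)` of the ends: the two sets together lose a
  -- node per step, and a set that has become empty stays empty.
  have key : ∀ q ≤ n, ∃ M' m', M - m ≤ M' - m' ∧ M' - m' ≤ M - m + 2 * q * e ∧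
      (∀ i ∈ N, v q i ≤ M') ∧ (∀ i ∈ N, m' ≤ v q i) ∧
      ((∀ i ∈ N, v q i ≤ M' - β ^ q * ((M - m) / 2)) ∨
        (∀ i ∈ N, m' + β ^ q * ((M - m) / 2) ≤ v q i) ∨
        (N.filter fun i => M' - β ^ q * ((M - m) / 2) < v q i).card +
          (N.filter fun i => v q i < m' + β ^ q * ((M - m) / 2)).card + q ≤ N.card) := by
    intro q
    induction q with
    | zero =>
      intro _
      refine ⟨M, m, le_rfl, by simp, hM, hm, Or.inr (Or.inr ?_)⟩
      rw [add_zero, ← Finset.card_union_of_disjoint]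
      · exact Finset.card_le_card (Finset.union_subset (Finset.filter_subset _ _)
          (Finset.filter_subset _ _))
      · rw [Finset.disjoint_filter]
        intro i _ h1 h2
        linarith
    | succ q ih =>
      intro hq
      obtain ⟨M', m', h1, h2, h3, h4, h5⟩ := ih (by omega)
      have hst := hstep q (by omega)
      set ε := β ^ q * ((M - m) / 2) with hε
      have hε0 : 0 ≤ ε := by
        have : 0 ≤ (M - m) / 2 := by linarith
        positivity
      have hε1 : ε ≤ (M - m) / 2 := by
        have h0 : 0 ≤ (M - m) / 2 := by linarith
        have := mul_le_mul_of_nonneg_right (pow_le_one₀ hβ.le hβ1 (n := q)) h0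
        linarith
      have hε' : β ^ (q + 1) * ((M - m) / 2) = β * ε := by rw [hε]; ring
      have hup : ∀ i ∈ N, v q i ≤ M' - ε → v (q + 1) i ≤ M' + c q + e - β * ε := by
        intro i hi h
        have := (hst i hi).1 M' ε hε0 h3 (Or.inl h)
        linarith
      have hlo : ∀ i ∈ N, m' + ε ≤ v q i → m' + c q - e + β * ε ≤ v (q + 1) i := by
        intro i hi h
        have := (hst i hi).2 m' ε hε0 h4 (Or.inl h)
        linarith
      refine ⟨M' + c q + e, m' + c q - e, by linarith, by push_cast; linarith, ?_, ?_, ?_⟩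
      · intro i hi
        have := (hst i hi).le_of_bound hi h3
        linarith
      · intro i hi
        have := (hst i hi).ge_of_bound hi h4
        linarith
      · rw [hε']
        rcases h5 with h5 | h5 | h5
        · exact Or.inl fun i hi => hup i hi (h5 i hi)
        · exact Or.inr (Or.inl fun i hi => hlo i hi (h5 i hi))
        by_cases hH : ∀ i ∈ N, v q i ≤ M' - ε
        · exact Or.inl fun i hi => hup i hi (hH i hi)
        by_cases hL : ∀ i ∈ N, m' + ε ≤ v q i
        · exact Or.inr (Or.inl fun i hi => hlo i hi (hL i hi))
        push Not at hH hL
        refine Or.inr (Or.inr ?_)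
        obtain ⟨a, ha, ha'⟩ := hH
        obtain ⟨b, hb, hb'⟩ := hL
        have hsub1 : (N.filter fun i => M' + c q + e - β * ε < v (q + 1) i) ⊆
            N.filter fun i => M' - ε < v q i := by
          intro i hi
          rw [Finset.mem_filter] at hi ⊢
          refine ⟨hi.1, ?_⟩
          by_contra hcon
          linarith [hup i hi.1 (not_lt.1 hcon), hi.2]
        have hsub2 : (N.filter fun i => v (q + 1) i < m' + c q - e + β * ε) ⊆
            N.filter fun i => v q i < m' + ε := by
          intro i hi
          rw [Finset.mem_filter] at hi ⊢
          refine ⟨hi.1, ?_⟩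
          by_contra hcon
          linarith [hlo i hi.1 (not_lt.1 hcon), hi.2]
        have hdisj : Disjoint {i | i ∈ N ∧ M' - ε < v q i} {i | i ∈ N ∧ v q i < m' + ε} := by
          rw [Set.disjoint_left]
          rintro i ⟨_, hi⟩ ⟨_, hi'⟩
          linarith
        have hmem1 : a ∈ {i | i ∈ N ∧ M' - ε < v q i} := ⟨ha, ha'⟩
        have hmem2 : b ∈ {i | i ∈ N ∧ v q i < m' + ε} := ⟨hb, hb'⟩
        have hprop1 : {i | i ∈ N ∧ M' - ε < v q i} ⊂ Set.univ := by
          rw [Set.ssubset_univ_iff]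
          intro h
          exact Set.disjoint_left.1 hdisj (h ▸ Set.mem_univ b) hmem2
        have hprop2 : {i | i ∈ N ∧ v q i < m' + ε} ⊂ Set.univ := by
          rw [Set.ssubset_univ_iff]
          intro h
          exact Set.disjoint_left.1 hdisj hmem1 (h ▸ Set.mem_univ a)
        have hcard1 := Finset.card_le_card hsub1
        have hcard2 := Finset.card_le_card hsub2
        -- No node enters either set, because the margin shrinks by the factor `β`. Robustness
        -- provides a node with `2f + 1` in-neighbours outside its own set, and this node leaves.
        rcases hrobust _ _ ⟨a, hmem1⟩ ⟨b, hmem2⟩ hprop1 hprop2 hdisj with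
          ⟨i, hi, hr⟩ | ⟨i, hi, hr⟩
        · have hlt : (N.filter fun i => M' + c q + e - β * ε < v (q + 1) i).card <
              (N.filter fun i => M' - ε < v q i).card := by
            refine Finset.card_lt_card ⟨hsub1, fun h => ?_⟩
            have hi' := Finset.mem_filter.1 (h (Finset.mem_filter.2 ⟨hi.1, hi.2⟩))
            have hset : {j | G.Adj i j ∧ j ∉ {i | i ∈ N ∧ M' - ε < v q i}} =
                {j | G.Adj i j ∧ (j ∈ N → v q j ≤ M' - ε)} := by
              ext j; simp
            rw [hset] at hr
            have := (hst i hi.1).1 M' ε hε0 h3 (Or.inr hr)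
            linarith [hi'.2]
          omega
        · have hlt : (N.filter fun i => v (q + 1) i < m' + c q - e + β * ε).card <
              (N.filter fun i => v q i < m' + ε).card := by
            refine Finset.card_lt_card ⟨hsub2, fun h => ?_⟩
            have hi' := Finset.mem_filter.1 (h (Finset.mem_filter.2 ⟨hi.1, hi.2⟩))
            have hset : {j | G.Adj i j ∧ j ∉ {i | i ∈ N ∧ v q i < m' + ε}} =
                {j | G.Adj i j ∧ (j ∈ N → m' + ε ≤ v q j)} := by
              ext j; simp
            rw [hset] at hr
            have := (hst i hi.1).2 m' ε hε0 h4 (Or.inr hr)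
            linarith [hi'.2]
          omega
  obtain ⟨M', m', h1, h2, h3, h4, h5⟩ := key n le_rfl
  -- Two nonempty sets after `n` steps would need `n + 2` normal nodes.
  have hcases : (∀ i ∈ N, v n i ≤ M' - β ^ n * ((M - m) / 2)) ∨
      (∀ i ∈ N, m' + β ^ n * ((M - m) / 2) ≤ v n i) := by
    rcases h5 with h5 | h5 | h5
    · exact Or.inl h5
    · exact Or.inr h5
    by_contra! hcon
    obtain ⟨⟨a, ha, ha'⟩, b, hb, hb'⟩ := hcon
    have h1 : 0 < (N.filter fun i => M' - β ^ n * ((M - m) / 2) < v n i).card :=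
      Finset.card_pos.2 ⟨a, Finset.mem_filter.2 ⟨ha, ha'⟩⟩
    have h2 : 0 < (N.filter fun i => v n i < m' + β ^ n * ((M - m) / 2)).card :=
      Finset.card_pos.2 ⟨b, Finset.mem_filter.2 ⟨hb, hb'⟩⟩
    omega
  rcases hcases with h | h
  · exact ⟨_, m', h, h4, by linarith⟩
  · exact ⟨M', _, h3, h, by linarith⟩

/-! ### Widths of hulls and sequences that contract in blocks. -/

/-- The width of the hull of the values `v` on `N`. -/
noncomputable def width {V : Type*} (N : Finset V) (v : V → ℝ) : ℝ :=
  (⨆ i : N, v i) - ⨅ i : N, v i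

section Hull

variable {V : Type*} {N : Finset V} {v : V → ℝ}

theorem le_hull_sup {i : V} (hi : i ∈ N) : v i ≤ ⨆ i : N, v i :=
  le_ciSup (f := fun i : N => v i) (Set.finite_range _).bddAbove ⟨i, hi⟩

theorem hull_inf_le {i : V} (hi : i ∈ N) : ⨅ i : N, v i ≤ v i :=
  ciInf_le (f := fun i : N => v i) (Set.finite_range _).bddBelow ⟨i, hi⟩

theorem hull_sup_le (hN : N.Nonempty) {M : ℝ} (h : ∀ i ∈ N, v i ≤ M) : ⨆ i : N, v i ≤ M :=
  have := hN.to_subtype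
  ciSup_le fun i => h i i.2

theorem le_hull_inf (hN : N.Nonempty) {m : ℝ} (h : ∀ i ∈ N, m ≤ v i) : m ≤ ⨅ i : N, v i :=
  have := hN.to_subtype
  le_ciInf fun i => h i i.2

theorem width_nonneg (hN : N.Nonempty) : 0 ≤ width N v := by
  obtain ⟨i, hi⟩ := hN
  exact sub_nonneg.2 ((hull_inf_le hi).trans (le_hull_sup hi))

theorem width_le (hN : N.Nonempty) {m M : ℝ} (h1 : ∀ i ∈ N, m ≤ v i) (h2 : ∀ i ∈ N, v i ≤ M) :
    width N v ≤ M - m :=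
  sub_le_sub (hull_sup_le hN h2) (le_hull_inf hN h1)

end Hull

theorem width_contraction {V : Type*} {G : Digraph V} {N : Finset V} {f : ℕ} (hN : N.Nonempty)
    (hrobust : IsRobust G (2 * f + 1)) {β e : ℝ} (hβ : 0 < β) (hβ1 : β ≤ 1) (he : 0 ≤ e)
    {v : ℕ → V → ℝ} {c : ℕ → ℝ} {a n : ℕ}
    (hstep : ∀ q, a ≤ q → q < a + n → ∀ i ∈ N,
      ConsensusStep G N f β e (v q) i (v (q + 1) i - c q))
    (hn : N.card ≤ n + 1) :
    width N (v (a + n)) ≤ (1 - β ^ n / 2) * width N (v a) + 2 * n * e := by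
  obtain ⟨M', m', h1, h2, h3⟩ := consensus_contraction hrobust hβ hβ1 he
    (v := fun q => v (a + q)) (c := fun q => c (a + q)) (n := n)
    (fun q hq i hi => hstep (a + q) (by omega) (by omega) i hi)
    (fun i hi => le_hull_sup hi) (fun i hi => hull_inf_le hi)
    (sub_nonneg.1 (width_nonneg hN)) hn
  exact (width_le hN h2 h1).trans h3

/-- A nonincreasing sequence that contracts every `n` steps, up to a horizon `p`, has a sum bounded
by that of a geometric series. -/
theorem sum_le_of_contraction {δ : ℕ → ℝ} {κ : ℝ} {n p : ℕ} (hκ : κ < 1) (hκ0 : 0 ≤ κ) (hn : 1 ≤ n)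
    (hδ : ∀ q, 0 ≤ δ q) (hanti : ∀ q < p, δ (q + 1) ≤ δ q)
    (hcon : ∀ q, q + n ≤ p → δ (q + n) ≤ κ * δ q) :
    ∑ q ∈ Finset.range (p + 1), δ q ≤ n / (1 - κ) * δ 0 := by
  have hanti' : ∀ b a, a + b ≤ p → δ (a + b) ≤ δ a := by
    intro b
    induction b with
    | zero => intro a _; exact le_rfl
    | succ b ih => intro a h; exact (hanti (a + b) (by omega)).trans (ih a (by omega))
  have h1 : 0 < 1 - κ := by linarith
  -- The first `n` terms are at most `δ a` each, and the rest restarts from `δ (a + n) ≤ κ * δ a`.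
  -- The constant `n / (1 - κ)` solves `x = n + κ * x`.
  have key : ∀ m a, a + m = p → ∑ q ∈ Finset.range (m + 1), δ (a + q) ≤ n / (1 - κ) * δ a := by
    intro m
    induction m using Nat.strong_induction_on with
    | _ m ih =>
      intro a ha
      have hshort : ∀ l, l ≤ n → l ≤ m + 1 →
          ∑ q ∈ Finset.range l, δ (a + q) ≤ n * δ a := by
        intro l hl hl'
        calc ∑ q ∈ Finset.range l, δ (a + q) ≤ ∑ _q ∈ Finset.range l, δ a :=
              Finset.sum_le_sum fun q hq => hanti' q a (by rw [Finset.mem_range] at hq; omega)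
          _ = l * δ a := by simp
          _ ≤ n * δ a := mul_le_mul_of_nonneg_right (by exact_mod_cast hl) (hδ a)
      by_cases hmn : m + 1 ≤ n
      · refine (hshort _ hmn le_rfl).trans (mul_le_mul_of_nonneg_right ?_ (hδ a))
        rw [le_div_iff₀ h1]
        nlinarith [(Nat.cast_nonneg n : (0 : ℝ) ≤ n)]
      · have hsplit : m + 1 = n + (m - n + 1) := by omega
        rw [hsplit, Finset.sum_range_add]
        have h2 := ih (m - n) (by omega) (a + n) (by omega)
        have h3 := hshort n le_rfl (by omega)
        have h4 := hcon a (by omega)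
        have h5 : (n : ℝ) / (1 - κ) * δ (a + n) ≤ n / (1 - κ) * (κ * δ a) := by gcongr
        have h6 : (n : ℝ) / (1 - κ) * δ a = n * δ a + n / (1 - κ) * (κ * δ a) := by
          field_simp; ring
        simp only [← add_assoc] at h2 ⊢
        linarith
  simpa using key p 0 (by omega)

/-- A nonnegative sequence that contracts every `n` steps decays exponentially. -/
theorem exists_geometric_bound {a : ℕ → ℝ} {κ : ℝ} {n : ℕ} (hn : 1 ≤ n) (hκ0 : 0 < κ) (hκ : κ < 1)
    (ha : ∀ q, 0 ≤ a q) (hcon : ∀ q, a (q + n) ≤ κ * a q) :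
    ∃ C ρ : ℝ, 0 ≤ C ∧ 0 < ρ ∧ ρ < 1 ∧ ∀ q, a q ≤ C * ρ ^ q := by
  have hn0 : n ≠ 0 := by omega
  set ρ : ℝ := κ ^ ((n : ℝ)⁻¹) with hρ
  have hρn : ρ ^ n = κ := Real.rpow_inv_natCast_pow hκ0.le hn0
  have hρ0 : 0 < ρ := Real.rpow_pos_of_pos hκ0 _
  have hρ1 : ρ < 1 := Real.rpow_lt_one hκ0.le hκ (by positivity)
  set s := ∑ r ∈ Finset.range n, a r with hs
  have hs0 : 0 ≤ s := Finset.sum_nonneg fun r _ => ha r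
  -- With `ρ ^ n = κ`, the factor `1 / κ` covers the first `n` terms, where only `κ ≤ ρ ^ q` is
  -- known.
  refine ⟨s / κ, ρ, by positivity, hρ0, hρ1, fun q => ?_⟩
  induction q using Nat.strong_induction_on with
  | _ q ih =>
    by_cases hq : q < n
    · have h1 : a q ≤ s :=
        Finset.single_le_sum (f := a) (fun r _ => ha r) (Finset.mem_range.2 hq)
      have h2 : κ ≤ ρ ^ q := hρn ▸ pow_le_pow_of_le_one hρ0.le hρ1.le hq.le
      calc a q ≤ s := h1
        _ = s / κ * κ := by field_simp
        _ ≤ s / κ * ρ ^ q := by gcongr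
    · have h1 := ih (q - n) (by omega)
      have h2 := hcon (q - n)
      have h3 : q - n + n = q := by omega
      rw [h3] at h2
      calc a q ≤ κ * (s / κ * ρ ^ (q - n)) := h2.trans (by gcongr)
        _ = s / κ * (ρ ^ (q - n) * ρ ^ n) := by rw [hρn]; ring
        _ = s / κ * ρ ^ q := by rw [← pow_add, h3]

/-! ### Trimming of the received values and the frequency update as a consensus step. -/

namespace OscState

theorem sort_eq_perm (F : Multiset ℝ) : ((F.sort (· ≤ ·) : List ℝ) : Multiset ℝ) = F :=
  F.sort_eq _

theorem card_filter_eq_length (F : Multiset ℝ) (p : ℝ → Prop) [DecidablePred p] :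
    Multiset.card (F.filter p) = ((F.sort (· ≤ ·)).filter p).length := by
  calc Multiset.card (F.filter p)
      = Multiset.card (((F.sort (· ≤ ·) : List ℝ) : Multiset ℝ).filter p) := by rw [sort_eq_perm]
    _ = _ := by rw [Multiset.filter_coe, Multiset.coe_card]

theorem exists_index_of_mem_trimmed {F : Multiset ℝ} {m : ℕ} {x : ℝ} (hx : x ∈ trimmed F m) :
    ∃ a b : List ℝ, F.sort (· ≤ ·) = a ++ x :: b ∧ m ≤ a.length ∧ m ≤ b.length := by
  have hlen : (F.sort (· ≤ ·)).length = Multiset.card F := F.length_sort _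
  obtain ⟨n, hn, rfl⟩ := List.mem_iff_getElem.1 hx
  have hn' := hn
  simp only [trimmed, List.length_take, List.length_drop, hlen] at hn'
  have h1 : m + n < (F.sort (· ≤ ·)).length := by omega
  refine ⟨(F.sort (· ≤ ·)).take (m + n), (F.sort (· ≤ ·)).drop (m + n + 1), ?_, ?_, ?_⟩
  · have : (trimmed F m)[n] = (F.sort (· ≤ ·))[m + n] := by
      simp [trimmed]
    rw [this, List.getElem_cons_drop, List.take_append_drop]
  · rw [List.length_take]; omega
  · rw [List.length_drop]; omega

/-- At least `m` entries precede `x` in the sorted list, and `x` itself makes the count exceed `m`.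
So if at most `m` values are false, a true value lies at or below `x`. -/
theorem lt_card_le_of_mem_trimmed {F : Multiset ℝ} {m : ℕ} {x : ℝ} (hx : x ∈ trimmed F m) :
    m < Multiset.card (F.filter (· ≤ x)) := by
  obtain ⟨a, b, h, ha, -⟩ := exists_index_of_mem_trimmed hx
  have hs : (F.sort (· ≤ ·)).Pairwise (· ≤ ·) := F.pairwise_sort _
  rw [h, List.pairwise_append] at hs
  have hF : F = (a : Multiset ℝ) + (x ::ₘ (b : Multiset ℝ)) := by
    conv_lhs => rw [← sort_eq_perm F, h]
    simp
  have h2 : (a : Multiset ℝ).filter (· ≤ x) = a := by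
    rw [Multiset.filter_eq_self]
    intro y hy
    exact hs.2.2 y hy x (by simp)
  rw [hF, Multiset.filter_add, h2, Multiset.filter_cons_of_pos (p := (· ≤ x)) _ (le_refl x)]
  simp
  omega

theorem lt_card_ge_of_mem_trimmed {F : Multiset ℝ} {m : ℕ} {x : ℝ} (hx : x ∈ trimmed F m) :
    m < Multiset.card (F.filter (x ≤ ·)) := by
  obtain ⟨a, b, h, -, hb⟩ := exists_index_of_mem_trimmed hx
  have hs : (F.sort (· ≤ ·)).Pairwise (· ≤ ·) := F.pairwise_sort _
  rw [h, List.pairwise_append, List.pairwise_cons] at hs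
  have hF : F = (a : Multiset ℝ) + (x ::ₘ (b : Multiset ℝ)) := by
    conv_lhs => rw [← sort_eq_perm F, h]
    simp
  have h2 : (b : Multiset ℝ).filter (x ≤ ·) = b := by
    rw [Multiset.filter_eq_self]
    intro y hy
    exact hs.2.1.1 y hy
  rw [hF, Multiset.filter_add, Multiset.filter_cons_of_pos _ le_rfl, h2]
  simp
  omega

/-- The smallest retained value is the sorted entry of index `m`. If it exceeded `c`, only the `m`
discarded smallest entries could be at most `c`. -/
theorem exists_mem_trimmed_le {F : Multiset ℝ} {m : ℕ} {c : ℝ} (hF : 2 * m < Multiset.card F)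
    (hc : m < Multiset.card (F.filter (· ≤ c))) : ∃ x ∈ trimmed F m, x ≤ c := by
  have hlen : (F.sort (· ≤ ·)).length = Multiset.card F := F.length_sort _
  have h1 : m < (F.sort (· ≤ ·)).length := by omega
  have h0 : 0 < (trimmed F m).length := by
    simp only [trimmed, List.length_take, List.length_drop, hlen]; omega
  have he : (trimmed F m)[0] = (F.sort (· ≤ ·))[m] := by simp [trimmed]
  refine ⟨(trimmed F m)[0], List.getElem_mem h0, ?_⟩
  rw [he]
  by_contra! hcon
  have hs : (F.sort (· ≤ ·)).Pairwise (· ≤ ·) := F.pairwise_sort _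
  have hsplit : F.sort (· ≤ ·) = (F.sort (· ≤ ·)).take m ++ (F.sort (· ≤ ·)).drop m :=
    (List.take_append_drop _ _).symm
  have hd : ((F.sort (· ≤ ·)).drop m).filter (· ≤ c) = [] := by
    rw [List.filter_eq_nil_iff]
    intro y hy
    obtain ⟨n, hn, rfl⟩ := List.mem_iff_getElem.1 hy
    rw [List.getElem_drop]
    have : (F.sort (· ≤ ·))[m] ≤ (F.sort (· ≤ ·))[m + n]'(by
        rw [List.length_drop] at hn; omega) := by
      rcases Nat.eq_zero_or_pos n with rfl | hn0
      · exact le_rfl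
      · exact List.pairwise_iff_getElem.1 hs _ _ _ _ (by omega)
    simpa using hcon.trans_le this
  rw [card_filter_eq_length, hsplit, List.filter_append, hd, List.append_nil] at hc
  have := List.length_filter_le (fun y => decide (y ≤ c)) ((F.sort (· ≤ ·)).take m)
  rw [List.length_take] at this
  omega

theorem exists_mem_trimmed_ge {F : Multiset ℝ} {m : ℕ} {c : ℝ} (hF : 2 * m < Multiset.card F)
    (hc : m < Multiset.card (F.filter (c ≤ ·))) : ∃ x ∈ trimmed F m, c ≤ x := by
  have hlen : (F.sort (· ≤ ·)).length = Multiset.card F := F.length_sort _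
  set n := Multiset.card F - 2 * m - 1 with hn
  have h1 : m + n < (F.sort (· ≤ ·)).length := by omega
  have h0 : n < (trimmed F m).length := by
    simp only [trimmed, List.length_take, List.length_drop, hlen]; omega
  have he : (trimmed F m)[n] = (F.sort (· ≤ ·))[m + n] := by simp [trimmed]
  refine ⟨(trimmed F m)[n], List.getElem_mem h0, ?_⟩
  rw [he]
  by_contra! hcon
  have hs : (F.sort (· ≤ ·)).Pairwise (· ≤ ·) := F.pairwise_sort _
  have hsplit : F.sort (· ≤ ·) =
      (F.sort (· ≤ ·)).take (m + n + 1) ++ (F.sort (· ≤ ·)).drop (m + n + 1) :=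
    (List.take_append_drop _ _).symm
  have hd : ((F.sort (· ≤ ·)).take (m + n + 1)).filter (c ≤ ·) = [] := by
    rw [List.filter_eq_nil_iff]
    intro y hy
    obtain ⟨l, hl, rfl⟩ := List.mem_iff_getElem.1 hy
    rw [List.getElem_take]
    rw [List.length_take] at hl
    have : (F.sort (· ≤ ·))[l]'(by omega) ≤ (F.sort (· ≤ ·))[m + n] := by
      rcases Nat.lt_or_ge l (m + n) with h | h
      · exact List.pairwise_iff_getElem.1 hs _ _ _ _ h
      · have : l = m + n := by omega
        subst this; exact le_rfl
    simpa using this.trans_lt hcon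
  rw [card_filter_eq_length, hsplit, List.filter_append, hd, List.nil_append] at hc
  have := List.length_filter_le (fun y => decide (c ≤ y)) ((F.sort (· ≤ ·)).drop (m + n + 1))
  rw [List.length_drop] at this
  omega

end OscState

/-- The deficit of the average from `M` is a sum of nonnegative weighted deficits, and the one low
value alone contributes `α * ε`. -/
theorem weighted_le {n : ℕ} {α a₀ x₀ M ε : ℝ} {a x : Fin n → ℝ} (hα : 0 ≤ α) (hε : 0 ≤ ε)
    (h₀ : α ≤ a₀) (h : ∀ m, α ≤ a m) (hsum : a₀ + ∑ m, a m = 1) (hx₀ : x₀ ≤ M)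
    (hx : ∀ m, x m ≤ M) (hlow : x₀ ≤ M - ε ∨ ∃ m, x m ≤ M - ε) :
    a₀ * x₀ + ∑ m, a m * x m ≤ M - α * ε := by
  have h1 : M - (a₀ * x₀ + ∑ m, a m * x m) = a₀ * (M - x₀) + ∑ m, a m * (M - x m) := by
    simp only [mul_sub, Finset.sum_sub_distrib, ← Finset.sum_mul]
    linear_combination (-M) * hsum
  have h2 : 0 ≤ a₀ * (M - x₀) := mul_nonneg (hα.trans h₀) (by linarith)
  have h3 : ∀ m, 0 ≤ a m * (M - x m) := fun m => mul_nonneg (hα.trans (h m)) (by linarith [hx m])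
  suffices α * ε ≤ a₀ * (M - x₀) + ∑ m, a m * (M - x m) by linarith
  rcases hlow with hl | ⟨m, hl⟩
  · have : α * ε ≤ a₀ * (M - x₀) := mul_le_mul h₀ (by linarith) hε (hα.trans h₀)
    linarith [Finset.sum_nonneg fun m (_ : m ∈ Finset.univ) => h3 m]
  · have : α * ε ≤ a m * (M - x m) := mul_le_mul (h m) (by linarith) hε (hα.trans (h m))
    linarith [Finset.single_le_sum (f := fun m => a m * (M - x m)) (fun m _ => h3 m)
      (Finset.mem_univ m)]

theorem le_weighted {n : ℕ} {α a₀ x₀ M ε : ℝ} {a x : Fin n → ℝ} (hα : 0 ≤ α) (hε : 0 ≤ ε)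
    (h₀ : α ≤ a₀) (h : ∀ m, α ≤ a m) (hsum : a₀ + ∑ m, a m = 1) (hx₀ : M ≤ x₀)
    (hx : ∀ m, M ≤ x m) (hhigh : M + ε ≤ x₀ ∨ ∃ m, M + ε ≤ x m) :
    M + α * ε ≤ a₀ * x₀ + ∑ m, a m * x m := by
  have := weighted_le (x₀ := -x₀) (M := -M) (x := fun m => -x m) hα hε h₀ h hsum (by linarith)
    (fun m => by linarith [hx m]) (by
      rcases hhigh with h | ⟨m, h⟩
      · exact Or.inl (by linarith)
      · exact Or.inr ⟨m, by linarith⟩)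
  simp only [mul_neg, Finset.sum_neg_distrib] at this
  linarith

theorem OscState.IsNewFreq.le_one {V : Type*} {G : Digraph V} {f : ℕ} {α : ℝ} {S : OscState V}
    {i : V} {ω : ℝ} (h : S.IsNewFreq G f α i ω) (hα : 0 ≤ α) : α ≤ 1 := by
  obtain ⟨a₀, a, h₀, ha, hsum, -⟩ := h
  linarith [Finset.sum_nonneg fun m (_ : m ∈ Finset.univ) => hα.trans (ha m)]

section Neighbours

variable {V : Type*} [Fintype V] {G : Digraph V} {N : Finset V} {f : ℕ}

/-- Robustness is tested on `{i}` and its complement, whose nodes have at most one in-neighbour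
outside it. In-degrees strictly between `f` and `2f + 1` would spoil the order of the two correction
thresholds; for `d ≤ f` neither threshold is ever reached. -/
theorem inDegree_dichotomy (hrobust : IsRobust G (2 * f + 1)) (i : V) :
    2 * f + 1 ≤ inDegree G i ∨ inDegree G i ≤ f := by
  classical
  rcases Nat.eq_zero_or_pos f with rfl | hf
  · omega
  by_cases h : ∃ j, j ≠ i
  · obtain ⟨j, hj⟩ := h
    left
    have hp1 : ({i} : Set V) ⊂ Set.univ := by
      rw [Set.ssubset_univ_iff]; intro h
      exact hj (h.symm ▸ Set.mem_univ j : j ∈ ({i} : Set V))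
    have hp2 : ({i}ᶜ : Set V) ⊂ Set.univ := by
      rw [Set.ssubset_univ_iff]; intro h
      exact (h.symm ▸ Set.mem_univ i : i ∈ ({i}ᶜ : Set V)) rfl
    rcases hrobust {i} {i}ᶜ ⟨i, rfl⟩ ⟨j, hj⟩ hp1 hp2 disjoint_compl_right with
      ⟨l, rfl, hr⟩ | ⟨l, _, hr⟩
    · exact hr.trans (Set.ncard_le_ncard (fun _ h => h.1) (Set.toFinite _))
    · have : {j | G.Adj l j ∧ j ∉ ({i}ᶜ : Set V)}.ncard ≤ ({i} : Set V).ncard :=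
        Set.ncard_le_ncard (fun j h => by simpa using h.2) (Set.toFinite _)
      rw [Set.ncard_singleton] at this
      omega
  · right
    push Not at h
    have : inDegree G i ≤ ({i} : Set V).ncard :=
      Set.ncard_le_ncard (fun j _ => h j) (Set.toFinite _)
    rw [Set.ncard_singleton] at this
    omega

open Classical in
/-- The normal in-neighbours of `i`. -/
noncomputable def normalNbrs (G : Digraph V) (N : Finset V) (i : V) : Finset V :=
  N.filter (G.Adj i ·)

/-- The number of misbehaving in-neighbours of `i`. -/
noncomputable def numFaulty (G : Digraph V) (N : Finset V) (i : V) : ℕ :=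
  {j | G.Adj i j ∧ j ∉ N}.ncard

theorem inDegree_eq (i : V) : inDegree G i = (normalNbrs G N i).card + numFaulty G N i := by
  classical
  rw [inDegree, numFaulty, ← Set.ncard_coe_finset, ← Set.ncard_union_eq]
  · congr 1; ext j; simp [normalNbrs]; tauto
  · rw [Set.disjoint_left]; intro j h1 h2
    simp [normalNbrs] at h1
    exact h2.2 h1.1

theorem numFaulty_add_card_le (i : V) : numFaulty G N i + N.card ≤ Fintype.card V := by
  classical
  rw [numFaulty, ← Set.ncard_coe_finset, ← Set.ncard_union_eq, ← Nat.card_eq_fintype_card,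
    ← Set.ncard_univ]
  · exact Set.ncard_le_ncard (Set.subset_univ _) (Set.toFinite _)
  · rw [Set.disjoint_left]; intro j h1 h2
    exact h1.2 h2

theorem inDegree_le_card (i : V) : inDegree G i ≤ Fintype.card V := by
  rw [← Nat.card_eq_fintype_card, ← Set.ncard_univ]
  exact Set.ncard_le_ncard (Set.subset_univ _) (Set.toFinite _)

open Classical in
/-- If `i` has `r` in-neighbours that are misbehaving or satisfy `P`, then so many of its normal
in-neighbours satisfy `P`. -/
theorem card_filter_normalNbrs_add (i : V) (P : V → Prop) {r : ℕ}
    (h : r ≤ {j | G.Adj i j ∧ (j ∈ N → P j)}.ncard) :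
    r ≤ ((normalNbrs G N i).filter P).card + numFaulty G N i := by
  refine h.trans ?_
  rw [numFaulty, ← Set.ncard_coe_finset]
  refine (Set.ncard_le_ncard ?_ (Set.toFinite _)).trans (Set.ncard_union_le _ _)
  intro j hj
  by_cases hN : j ∈ N
  · left; simpa [normalNbrs, hN] using ⟨hj.1, hj.2 hN⟩
  · right; exact ⟨hj.1, hN⟩

open Classical in
/-- The new frequency is a resilient consensus step, provided that all normal in-neighbours have
been heard exactly once and the attack is not detected. -/
theorem OscState.IsNewFreq.consensusStep {α : ℝ} {S : OscState V} {i : V} {ω : ℝ}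
    (h : S.IsNewFreq G f α i ω) (hα : 0 ≤ α) {v : V → ℝ} {Ms : Multiset ℝ}
    (hv : S.freq i = v i) (hi : i ∈ N)
    (hvals : S.vals i = (normalNbrs G N i).val.map v + Ms)
    (hcount : S.count i = (normalNbrs G N i).card + Multiset.card Ms)
    (hle : S.count i ≤ inDegree G i) (hfault : numFaulty G N i ≤ f) :
    ConsensusStep G N f α 0 v i ω := by
  obtain ⟨a₀, a, h₀, ha, hsum, rfl⟩ := h
  have hd := inDegree_eq (G := G) (N := N) i
  have hcard : Multiset.card (S.vals i) = S.count i := by rw [hvals, hcount]; simp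
  -- At most `f` of the `2f + 1` in-neighbours misbehave, so at least `f + 1` normal ones remain,
  -- more than the `f + c - d ≤ f` trimmed at one end. Also `2f + 1 ≤ d` and `c ≤ d` give `2 * (f +
  -- c - d) < c`, so something is retained.
  have hnbr : ∀ P : V → Prop, 2 * f + 1 ≤ {j | G.Adj i j ∧ (j ∈ N → P j)}.ncard →
      f + S.count i - inDegree G i < ((normalNbrs G N i).filter P).card ∧
      2 * (f + S.count i - inDegree G i) < Multiset.card (S.vals i) := by
    intro P hP
    have h1 := card_filter_normalNbrs_add i P hP
    have h2 : ((normalNbrs G N i).filter P).card ≤ (normalNbrs G N i).card :=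
      Finset.card_filter_le _ _
    omega
  have hfil : ∀ P : ℝ → Prop, Multiset.card ((S.vals i).filter P) =
      ((normalNbrs G N i).filter fun j => P (v j)).card + Multiset.card (Ms.filter P) := by
    intro P
    rw [hvals, Multiset.filter_add, Multiset.card_add, Multiset.filter_map, Multiset.card_map]
    rfl
  -- All normal in-neighbours are among the `c` counted pulses, so there are `c - d + numFaulty G N
  -- i ≤ f + c - d` further values. The same inequality shows that the natural subtraction does not
  -- truncate.
  have hms : ∀ P : ℝ → Prop, Multiset.card (Ms.filter P) ≤ f + S.count i - inDegree G i := by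
    intro P
    have := Multiset.card_le_card (Multiset.filter_le P Ms)
    omega
  have hnorm : ∀ P : ℝ → Prop, f + S.count i - inDegree G i <
      Multiset.card ((S.vals i).filter P) → ∃ j ∈ N, P (v j) := by
    intro P hP
    rw [hfil] at hP
    have : 0 < ((normalNbrs G N i).filter fun j => P (v j)).card := by
      have := hms P
      omega
    obtain ⟨j, hj⟩ := Finset.card_pos.1 this
    rw [Finset.mem_filter, normalNbrs, Finset.mem_filter] at hj
    exact ⟨j, hj.1.1, hj.2⟩
  refine ⟨fun M ε hε hM hc => ?_, fun m ε hε hm hc => ?_⟩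
  · rw [add_zero]
    refine weighted_le hα hε h₀ ha hsum (hv ▸ hM i hi) (fun n => ?_) ?_
    · obtain ⟨j, hj, hj'⟩ := hnorm _ (lt_card_ge_of_mem_trimmed (List.get_mem (S.retained G f i) n))
      exact hj'.trans (hM j hj)
    · rcases hc with hc | hc
      · exact Or.inl (hv ▸ hc)
      · obtain ⟨h1, h2⟩ := hnbr _ hc
        obtain ⟨x, hx, hx'⟩ := exists_mem_trimmed_le (c := M - ε) h2 (by rw [hfil]; omega)
        obtain ⟨n, hn⟩ := List.get_of_mem (l := S.retained G f i) hx
        exact Or.inr ⟨n, hn ▸ hx'⟩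
  · rw [sub_zero]
    refine le_weighted hα hε h₀ ha hsum (hv ▸ hm i hi) (fun n => ?_) ?_
    · obtain ⟨j, hj, hj'⟩ := hnorm _ (lt_card_le_of_mem_trimmed (List.get_mem (S.retained G f i) n))
      exact (hm j hj).trans hj'
    · rcases hc with hc | hc
      · exact Or.inl (hv ▸ hc)
      · obtain ⟨h1, h2⟩ := hnbr _ hc
        obtain ⟨x, hx, hx'⟩ := exists_mem_trimmed_ge (c := m + ε) h2 (by rw [hfil]; omega)
        obtain ⟨n, hn⟩ := List.get_of_mem (l := S.retained G f i) hx
        exact Or.inr ⟨n, hn ▸ hx'⟩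

end Neighbours

/-! ### Lifted phases, rounds, and the meaning of the stored corrections. -/

namespace OscState

variable {V : Type*}

/-- The number of times `j` has fired, if it has updated `U j` times. -/
def fires (U : V → ℕ) (S : OscState V) (j : V) : ℕ := U j + (S.flag j).toNat

/-- The phase of `j` lifted to the real line. -/
def lift (U : V → ℕ) (S : OscState V) (j : V) : ℝ := fires U S j + S.phase j

/-- All normal phases lie, after lifting, in an open half circle. -/
def Close (N : Finset V) (U : V → ℕ) (S : OscState V) : Prop :=
  ∀ i ∈ N, ∀ j ∈ N, lift U S i < lift U S j + 1 / 2

open Classical in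
/-- The normal in-neighbours that `i` has heard since its last update. -/
noncomputable def heard (G : Digraph V) (N : Finset V) (U : V → ℕ) (S : OscState V) (i : V) :
    Finset V :=
  (normalNbrs G N i).filter fun j => fires U S j = U i + 1

/-- The relations between phases, frequencies and rounds. Here `U i` is the number of updates of
`i`, `w q i` is the frequency of `i` after `q` updates, and `τ q i` is the time at which `i` fires
after `q` updates. -/
structure Timing (N : Finset V) (w τ : ℕ → V → ℝ) (U : V → ℕ) (S : OscState V) (t : ℝ) :
    Prop where
  freq_eq : ∀ i ∈ N, S.freq i = w (U i) i
  one_le : ∀ i ∈ N, ∀ q ≤ U i, 1 ≤ w q i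
  phase_eq : ∀ i ∈ N, (S.flag i).toNat + S.phase i = 1 + S.freq i * (t - τ (U i) i)
  phase_nonneg : ∀ i ∈ N, 0 ≤ S.phase i
  phase_le_one : ∀ i ∈ N, S.phase i ≤ 1
  phase_le_half : ∀ i ∈ N, S.flag i = true → S.phase i ≤ 1 / 2
  round_le : ∀ i ∈ N, ∀ j ∈ N, U i ≤ fires U S j
  le_round : ∀ i ∈ N, ∀ j ∈ N, fires U S j ≤ U i + 1
  time_le : ∀ i ∈ N, ∀ j ∈ N, fires U S j = U i + 1 → τ (U i) j ≤ t

open Classical in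
/-- `s` is the arrival time of the `c`-th pulse, if the pulses of the nodes in `h` arrived at the
times `τ` and an unspecified `count - h.card` further pulses arrived before time `t`. -/
structure PulseRank (h : Finset V) (count : ℕ) (τ : V → ℝ) (t : ℝ) (c : ℕ) (s : ℝ) : Prop where
  le : s ≤ t
  before : (h.filter fun j => τ j < s).card + 1 ≤ c
  upto : c + h.card ≤ (h.filter fun j => τ j ≤ s).card + count

/-- The relations between the pulses that `i` has received since its last update and its counter,
received values and corrections. Here `h` is the set of the normal nodes heard, `v` and `τ` are
their reported frequencies and firing times, and `d` is the in-degree of `i`. -/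
structure Pulses (f d : ℕ) (h : Finset V) (v τ : V → ℝ) (t : ℝ) (S : OscState V) (i : V) :
    Prop where
  vals : ∃ Ms : Multiset ℝ, S.vals i = h.val.map v + Ms ∧ S.count i = h.card + Multiset.card Ms
  zUp_mem : S.zUp i ∈ Set.Icc 0 (1 / 2)
  zLow_mem : S.zLow i ∈ Set.Icc (-(1 / 2)) 0
  -- The guard `count ≤ h.card + f` says that at most `f` false pulses have come so far. It may fail
  -- in the middle of a round, but the number of false pulses only grows within a round, so if the
  -- guard holds at the update it held throughout. The `max` reflects that a pulse after the own
  -- firing gives no forward correction.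
  zUp_eq : 2 * f + 1 ≤ d → f + 1 ≤ S.count i → S.count i ≤ h.card + f →
    ∃ s, PulseRank h (S.count i) τ t (f + 1) s ∧ S.zUp i = S.freq i * max 0 (τ i - s)
  zLow_eq : 2 * f + 1 ≤ d → d - f ≤ S.count i → S.count i ≤ h.card + f →
    ∃ s, PulseRank h (S.count i) τ t (d - f) s ∧ S.zLow i = -(S.freq i * max 0 (s - τ i))
  z_zero : d ≤ f → S.zUp i = 0 ∧ S.zLow i = 0

theorem PulseRank.mono {h : Finset V} {count : ℕ} {τ : V → ℝ} {t t' : ℝ} {c : ℕ} {s : ℝ}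
    (hr : PulseRank h count τ t c s) (ht : t ≤ t') : PulseRank h count τ t' c s :=
  ⟨hr.le.trans ht, hr.before, hr.upto⟩

theorem PulseRank.attack {h : Finset V} {count : ℕ} {τ : V → ℝ} {t : ℝ} {c : ℕ} {s : ℝ}
    (hr : PulseRank h count τ t c s) : PulseRank h (count + 1) τ t c s :=
  ⟨hr.le, hr.before, hr.upto.trans (by omega)⟩

open Classical in
theorem PulseRank.insert {h : Finset V} {count : ℕ} {τ : V → ℝ} {t : ℝ} {c : ℕ} {s : ℝ}
    (hr : PulseRank h count τ t c s) {j : V} (hj : j ∉ h) (ht : t = τ j) :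
    PulseRank (insert j h) (count + 1) τ t c s := by
  refine ⟨hr.le, ?_, ?_⟩
  · rw [Finset.filter_insert, if_neg (by rw [← ht]; exact not_lt.2 hr.le)]
    exact hr.before
  · rw [Finset.card_insert_of_notMem hj]
    have h1 := hr.upto
    have h2 : (h.filter fun j => τ j ≤ s).card ≤
        ((Insert.insert j h).filter fun j => τ j ≤ s).card :=
      Finset.card_le_card (Finset.filter_subset_filter _ (Finset.subset_insert _ _))
    omega

theorem Pulses.mono {f d : ℕ} {h : Finset V} {v τ : V → ℝ} {t t' : ℝ} {S S' : OscState V} {i : V}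
    (hp : Pulses f d h v τ t S i) (ht : t ≤ t') (h1 : S'.vals i = S.vals i)
    (h2 : S'.count i = S.count i) (h3 : S'.zUp i = S.zUp i) (h4 : S'.zLow i = S.zLow i)
    (h5 : S'.freq i = S.freq i) : Pulses f d h v τ t' S' i := by
  constructor
  · rw [h1, h2]; exact hp.vals
  · rw [h3]; exact hp.zUp_mem
  · rw [h4]; exact hp.zLow_mem
  · rw [h2, h3, h5]
    intro a b c
    obtain ⟨s, hs, hs'⟩ := hp.zUp_eq a b c
    exact ⟨s, hs.mono ht, hs'⟩
  · rw [h2, h4, h5]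
    intro a b c
    obtain ⟨s, hs, hs'⟩ := hp.zLow_eq a b c
    exact ⟨s, hs.mono ht, hs'⟩
  · rw [h3, h4]; exact hp.z_zero

open Classical in
/-- The reaction to a pulse preserves the relations of `Pulses`. -/
theorem Pulses.receive {G : Digraph V} {f : ℕ} {h h' : Finset V} {u v τ : V → ℝ} {t : ℝ}
    {S : OscState V} {i j : V} (hp : Pulses f (inDegree G i) h v τ t S i) (hadj : G.Adj i j)
    (hh : h' = h ∨ (j ∉ h ∧ h' = insert j h ∧ u i = v j ∧ τ j = t))
    (hτ : ∀ l ∈ h', τ l ≤ t) (hω : 0 ≤ S.freq i)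
    (hphase : (S.flag i).toNat + S.phase i = 1 + S.freq i * (t - τ i))
    (hphase0 : 0 ≤ S.phase i) (hphase1 : S.phase i ≤ 1)
    (hhalf : S.flag i = true → S.phase i ≤ 1 / 2)
    (hearly : h'.Nonempty → S.flag i = false → 1 / 2 < S.phase i)
    (hlate : S.flag i = true → S.phase i = 1 / 2 → inDegree G i ≤ h.card + f)
    (hcount : S.count i + 1 ≤ inDegree G i) :
    Pulses f (inDegree G i) h' v τ t (S.receive G f j u) i := by
  obtain ⟨Ms, hvals, hcard⟩ := hp.vals
  have hc : (S.receive G f j u).count i = S.count i + 1 := by simp [OscState.receive, hadj]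
  have hv : (S.receive G f j u).vals i = u i ::ₘ S.vals i := by simp [OscState.receive, hadj]
  have hω' : (S.receive G f j u).freq i = S.freq i := rfl
  have hsub : h ⊆ h' := by
    rcases hh with rfl | ⟨-, rfl, -⟩
    · exact le_rfl
    · exact Finset.subset_insert _ _
  have hh'le : h'.card ≤ h.card + 1 := by
    rcases hh with rfl | ⟨hj, rfl, -⟩
    · omega
    · rw [Finset.card_insert_of_notMem hj]
  have hrank : ∀ c, S.count i + 1 = c → PulseRank h' (S.count i + 1) τ t c t := by
    rintro c rfl
    refine ⟨le_rfl, ?_, ?_⟩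
    · have : (h'.filter fun l => τ l < t).card ≤ h.card := by
        refine Finset.card_le_card fun l hl => ?_
        rw [Finset.mem_filter] at hl
        rcases hh with rfl | ⟨_, rfl, _, h4⟩
        · exact hl.1
        · rcases Finset.mem_insert.1 hl.1 with rfl | h5
          · exact absurd hl.2 (by rw [h4]; exact lt_irrefl _)
          · exact h5
      omega
    · rw [Finset.filter_true_of_mem hτ]
      omega
  have hkeep : ∀ c s, PulseRank h (S.count i) τ t c s → PulseRank h' (S.count i + 1) τ t c s := by
    intro c s hr
    rcases hh with rfl | ⟨hj, rfl, -, h4⟩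
    · exact hr.attack
    · exact hr.insert hj h4.symm
  have hle' : S.count i + 1 ≤ h'.card + f → S.count i ≤ h.card + f := by omega
  -- At phase `1 / 2` with raised flag the algorithm would misread a late pulse as an early one. But
  -- then at least `d - f ≥ f + 1` pulses have already been counted, so both thresholds have been
  -- passed.
  have hnotlate : 2 * f + 1 ≤ inDegree G i →
      S.count i + 1 = f + 1 ∨ S.count i + 1 = inDegree G i - f →
      S.flag i = true → S.phase i < 1 / 2 := by
    intro hd hor hfl
    refine lt_of_le_of_ne (hhalf hfl) fun heq => ?_
    have := hlate hfl heq
    omega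
  -- A threshold pulse is at least the `(f + 1)`-st. With at most `f` false ones, some normal
  -- oscillator has been heard, which forces an unflagged receiver beyond phase `1 / 2`.
  have hne : ∀ c, f + 1 ≤ c → S.count i + 1 = c → S.count i + 1 ≤ h'.card + f → h'.Nonempty := by
    intro c h1 h2 h3
    rw [← Finset.card_pos]; omega
  constructor
  · rcases hh with rfl | ⟨hj, rfl, h3, -⟩
    · refine ⟨u i ::ₘ Ms, ?_, ?_⟩
      · rw [hv, hvals]; simp
      · rw [hc, hcard]; simp; ring
    · refine ⟨Ms, ?_, ?_⟩
      · rw [hv, hvals, Finset.insert_val_of_notMem hj, h3]; simp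
      · rw [hc, hcard, Finset.card_insert_of_notMem hj]; ring
  · have := hp.zUp_mem
    simp only [OscState.receive, Set.mem_Icc] at this ⊢
    split_ifs <;> constructor <;> linarith [this.1, this.2]
  · have := hp.zLow_mem
    simp only [OscState.receive, Set.mem_Icc] at this ⊢
    split_ifs <;> constructor <;> linarith [this.1, this.2]
  · rw [hc, hω']
    intro hd h1 h2
    by_cases hnew : S.count i + 1 = f + 1
    · refine ⟨t, hrank _ hnew, ?_⟩
      have hz : (S.receive G f j u).zUp i =
          if 1 / 2 ≤ S.phase i ∧ S.phase i < 1 then 1 - S.phase i else 0 := by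
        simp only [OscState.receive]; rw [if_pos ⟨hadj, hnew⟩]
      rw [hz]
      -- Without the flag the firing of `i` still lies ahead, at distance `1 - phase` in phase; with
      -- the flag it lies back by `phase`.
      cases hfl : S.flag i
      · have h3 := hearly (hne _ le_rfl hnew h2) hfl
        rw [hfl] at hphase
        simp only [Bool.toNat_false, Nat.cast_zero, zero_add] at hphase
        have h4 : S.freq i * max 0 (τ i - t) = max 0 (1 - S.phase i) := by
          rw [mul_max_of_nonneg _ _ hω, mul_zero]; congr 1; linarith
        rw [h4, max_eq_right (by linarith)]
        split_ifs with h5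
        · rfl
        · have : ¬ S.phase i < 1 := fun h6 => h5 ⟨h3.le, h6⟩
          linarith
      · have h3 := hnotlate hd (Or.inl hnew) hfl
        rw [hfl] at hphase
        simp only [Bool.toNat_true, Nat.cast_one] at hphase
        have h4 : S.freq i * max 0 (τ i - t) = max 0 (-S.phase i) := by
          rw [mul_max_of_nonneg _ _ hω, mul_zero]; congr 1; linarith
        rw [h4, max_eq_left (by linarith), if_neg (by rintro ⟨h5, -⟩; linarith)]
    · obtain ⟨s, hs, hs'⟩ := hp.zUp_eq hd (by omega) (hle' h2)
      refine ⟨s, hkeep _ _ hs, ?_⟩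
      rw [← hs']
      simp only [OscState.receive]; rw [if_neg (fun h => hnew h.2)]
  · rw [hc, hω']
    intro hd h1 h2
    by_cases hnew : S.count i + 1 = inDegree G i - f
    · refine ⟨t, hrank _ hnew, ?_⟩
      have hz : (S.receive G f j u).zLow i =
          if 0 ≤ S.phase i ∧ S.phase i < 1 / 2 then -S.phase i else 0 := by
        simp only [OscState.receive]; rw [if_pos ⟨hadj, by omega⟩]
      rw [hz]
      cases hfl : S.flag i
      · have h3 := hearly (hne _ (by omega) hnew h2) hfl
        rw [hfl] at hphase
        simp only [Bool.toNat_false, Nat.cast_zero, zero_add] at hphase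
        have h4 : S.freq i * max 0 (t - τ i) = max 0 (S.phase i - 1) := by
          rw [mul_max_of_nonneg _ _ hω, mul_zero]; congr 1; linarith
        rw [h4, max_eq_left (by linarith), if_neg (by rintro ⟨-, h5⟩; linarith), neg_zero]
      · have h3 := hnotlate hd (Or.inr hnew) hfl
        rw [hfl] at hphase
        simp only [Bool.toNat_true, Nat.cast_one] at hphase
        have h4 : S.freq i * max 0 (t - τ i) = max 0 (S.phase i) := by
          rw [mul_max_of_nonneg _ _ hω, mul_zero]; congr 1; linarith
        rw [h4, max_eq_right hphase0, if_pos ⟨hphase0, h3⟩]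
    · obtain ⟨s, hs, hs'⟩ := hp.zLow_eq hd (by omega) (hle' h2)
      refine ⟨s, hkeep _ _ hs, ?_⟩
      rw [← hs']
      simp only [OscState.receive]; rw [if_neg (fun h => hnew (by omega))]
  · intro hd
    obtain ⟨h1, h2⟩ := hp.z_zero hd
    simp only [OscState.receive]
    rw [if_neg (fun h => by omega), if_neg (fun h => by omega)]
    exact ⟨h1, h2⟩

section Update

variable [Fintype V] {G : Digraph V} {N : Finset V} {f : ℕ}

open Classical in
/-- Once all normal in-neighbours have been heard, the stored corrections of `i` amount to a
resilient consensus step of its firing time. -/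
theorem Pulses.consensusStep {v τ : V → ℝ} {t : ℝ} {S : OscState V} {i : V}
    (hp : Pulses f (inDegree G i) (normalNbrs G N i) v τ t S i) (hi : i ∈ N)
    (hle : S.count i ≤ inDegree G i) (hfault : numFaulty G N i ≤ f)
    (hdeg : 2 * f + 1 ≤ inDegree G i ∨ inDegree G i ≤ f) :
    ∃ y, S.zUp i + S.zLow i = 2 * S.freq i * (τ i - y) ∧
      ConsensusStep G N f (1 / 2) 0 τ i y := by
  have hd := inDegree_eq (G := G) (N := N) i
  obtain ⟨Ms, -, hcount⟩ := hp.vals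
  have hmemN : ∀ j ∈ normalNbrs G N i, j ∈ N := fun j hj => (Finset.mem_filter.1 hj).1
  rcases hdeg with hdeg | hdeg
  · obtain ⟨s, hs, hsz⟩ := hp.zUp_eq hdeg (by omega) (by omega)
    obtain ⟨s', hs', hsz'⟩ := hp.zLow_eq hdeg (by omega) (by omega)
    have hs1 : ∃ j ∈ normalNbrs G N i, τ j ≤ s := by
      have := hs.upto
      have h0 : 0 < ((normalNbrs G N i).filter fun j => τ j ≤ s).card := by omega
      obtain ⟨j, hj⟩ := Finset.card_pos.1 h0
      exact ⟨j, (Finset.mem_filter.1 hj).1, (Finset.mem_filter.1 hj).2⟩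
    have hs2 : ∃ j ∈ normalNbrs G N i, s' ≤ τ j := by
      by_contra! hcon
      have := hs'.before
      rw [Finset.filter_true_of_mem hcon] at this
      omega
    -- `s` and `s'` are the arrival times of the pulses number `f + 1` and `d - f`. Each is bounded
    -- on the relevant side by a normal firing time. The average gives the weight `1 / 2`: one half
    -- stays in the hull and the other moves away from its end.
    refine ⟨(min (τ i) s + max (τ i) s') / 2, ?_, ?_⟩
    · rw [hsz, hsz']
      have h1 : max 0 (τ i - s) = τ i - min (τ i) s := by
        rcases le_total (τ i) s with h | h
        · rw [max_eq_left (by linarith), min_eq_left h]; ring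
        · rw [max_eq_right (by linarith), min_eq_right h]
      have h2 : max 0 (s' - τ i) = max (τ i) s' - τ i := by
        rcases le_total (τ i) s' with h | h
        · rw [max_eq_right (by linarith), max_eq_right h]
        · rw [max_eq_left (by linarith), max_eq_left h]; ring
      rw [h1, h2]; ring
    · refine ⟨fun M ε hε hM hc => ?_, fun m ε hε hm hc => ?_⟩
      · obtain ⟨j, hj, hj'⟩ := hs2
        have h1 : max (τ i) s' ≤ M := max_le (hM i hi) (hj'.trans (hM j (hmemN j hj)))
        -- At least `f + 1` normal in-neighbours fired by `M - ε`, while at most `f` pulses of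
        -- normal in-neighbours arrived strictly before `s`.
        have h2 : min (τ i) s ≤ M - ε := by
          rcases hc with hc | hc
          · exact (min_le_left _ _).trans hc
          · have h3 := card_filter_normalNbrs_add i _ hc
            have h4 := hs.before
            by_contra! hcon
            have h5 : ((normalNbrs G N i).filter fun j => τ j ≤ M - ε).card ≤
                ((normalNbrs G N i).filter fun j => τ j < s).card := by
              refine Finset.card_le_card fun l hl => ?_
              rw [Finset.mem_filter] at hl ⊢
              exact ⟨hl.1, hl.2.trans_lt (hcon.trans_le (min_le_right _ _))⟩
            omega
        linarith
      · obtain ⟨j, hj, hj'⟩ := hs1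
        have h1 : m ≤ min (τ i) s := le_min (hm i hi) ((hm j (hmemN j hj)).trans hj')
        have h2 : m + ε ≤ max (τ i) s' := by
          rcases hc with hc | hc
          · exact hc.trans (le_max_left _ _)
          · have h3 := card_filter_normalNbrs_add i _ hc
            have h4 := hs'.upto
            by_contra! hcon
            have h5 : ((normalNbrs G N i).filter fun j => m + ε ≤ τ j).card +
                ((normalNbrs G N i).filter fun j => τ j ≤ s').card ≤ (normalNbrs G N i).card := by
              rw [← Finset.card_union_of_disjoint]
              · exact Finset.card_le_card (Finset.union_subset (Finset.filter_subset _ _)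
                  (Finset.filter_subset _ _))
              · rw [Finset.disjoint_filter]
                intro l _ h6 h7
                linarith [le_max_right (τ i) s']
            omega
        linarith
  -- With `d ≤ f` there are no corrections and `i` keeps its own firing time; `2f + 1` in-neighbours
  -- do not exist.
  · obtain ⟨h1, h2⟩ := hp.z_zero hdeg
    refine ⟨τ i, by rw [h1, h2]; ring, fun M ε hε hM hc => ?_, fun m ε hε hm hc => ?_⟩
    · rcases hc with hc | hc
      · linarith
      · have h3 := card_filter_normalNbrs_add i _ hc
        have h4 := Finset.card_filter_le (normalNbrs G N i) fun j => τ j ≤ M - ε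
        omega
    · rcases hc with hc | hc
      · linarith
      · have h3 := card_filter_normalNbrs_add i _ hc
        have h4 := Finset.card_filter_le (normalNbrs G N i) fun j => m + ε ≤ τ j
        omega

end Update

end OscState

/-! ### Preservation of the timing and pulse relations by flow, pulses, firings and updates. -/

namespace OscState

variable {V : Type*} {G : Digraph V} {N : Finset V} {f : ℕ} {α : ℝ}
  {w τ : ℕ → V → ℝ} {U : V → ℕ} {S S' : OscState V} {t : ℝ} {i j : V}

namespace Timing

theorem one_le_freq (h : Timing N w τ U S t) (hi : i ∈ N) : 1 ≤ S.freq i :=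
  h.freq_eq i hi ▸ h.one_le i hi _ le_rfl

theorem lift_eq (h : Timing N w τ U S t) (hi : i ∈ N) :
    lift U S i = U i + 1 + S.freq i * (t - τ (U i) i) := by
  have := h.phase_eq i hi
  simp only [lift, fires]
  push_cast
  linarith

theorem lift_le (h : Timing N w τ U S t) (hi : i ∈ N) : lift U S i ≤ U i + 3 / 2 := by
  have h1 := h.phase_le_one i hi
  have h2 := h.phase_le_half i hi
  simp only [lift, fires]
  cases hf : S.flag i
  · simp; linarith
  · simp; linarith [h2 hf]

theorem flow (h : Timing N w τ U S t) {r : ℝ} (hr : S.CanFlow N r) :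
    Timing N w τ U (S.flow r) (t + r) where
  freq_eq := h.freq_eq
  one_le := h.one_le
  phase_eq i hi := by
    have := h.phase_eq i hi
    simp only [OscState.flow]
    linarith
  phase_nonneg i hi := by
    have := mul_nonneg hr.1 (zero_le_one.trans (h.one_le_freq hi))
    have := h.phase_nonneg i hi
    simp only [OscState.flow]
    linarith
  phase_le_one i hi := (hr.2 i hi).1
  phase_le_half i hi hf := (hr.2 i hi).2 hf (h.phase_le_half i hi hf)
  round_le := h.round_le
  le_round := h.le_round
  time_le i hi j hj hij := (h.time_le i hi j hj hij).trans (le_add_of_nonneg_right hr.1)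

/-- When `i` is about to update, every normal oscillator has fired in the current round. -/
theorem fires_eq_of_update (h : Timing N w τ U S t) (hc : Close N U S) (hi : i ∈ N)
    (hflag : S.flag i = true) (hphase : S.phase i = 1 / 2) (hj : j ∈ N) :
    fires U S j = U i + 1 := by
  refine le_antisymm (h.le_round i hi j hj) ?_
  have h1 := hc i hi j hj
  have h2 : lift U S i = U i + 3 / 2 := by
    simp only [lift, fires, hflag, hphase]; push_cast; simp; ring
  have h3 := h.phase_le_one j hj
  by_contra hcon
  have h4 : (fires U S j : ℝ) ≤ U i := by exact_mod_cast (by omega : fires U S j ≤ U i)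
  have h5 : lift U S j = fires U S j + S.phase j := rfl
  linarith

/-- When `j` is about to fire, every normal oscillator has made its last update. -/
theorem round_eq_of_fire (h : Timing N w τ U S t) (hc : Close N U S) (hj : j ∈ N)
    (hphase : S.phase j = 1) : S.flag j = false ∧ ∀ i ∈ N, U i = U j := by
  have hflag : S.flag j = false := by
    by_contra hcon
    have := h.phase_le_half j hj (by simpa using hcon)
    linarith
  have hf : fires U S j = U j := by simp [fires, hflag]
  refine ⟨hflag, fun i hi => ?_⟩
  have h1 := h.round_le i hi j hj
  have h2 := hc j hj i hi
  have h3 := h.lift_le hi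
  have h4 : lift U S j = U j + 1 := by rw [lift, hf, hphase]
  have h5 : U j < U i + 1 := by
    by_contra! hcon
    have : (U i : ℝ) + 1 ≤ U j := by exact_mod_cast hcon
    linarith
  omega

end Timing

/-- The invariants of the timing and of the received pulses. -/
structure Coherent (G : Digraph V) (N : Finset V) (f : ℕ) (w τ : ℕ → V → ℝ) (U : V → ℕ)
    (S : OscState V) (t : ℝ) : Prop where
  timing : Timing N w τ U S t
  pulses : ∀ i ∈ N, Pulses f (inDegree G i) (heard G N U S i) (w (U i)) (τ (U i)) t S i

theorem Coherent.flow (h : Coherent G N f w τ U S t) {r : ℝ} (hr : S.CanFlow N r) :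
    Coherent G N f w τ U (S.flow r) (t + r) where
  timing := h.timing.flow hr
  pulses i hi := (h.pulses i hi).mono (le_add_of_nonneg_right hr.1) rfl rfl rfl rfl rfl

theorem mem_heard : j ∈ heard G N U S i ↔ j ∈ normalNbrs G N i ∧ fires U S j = U i + 1 := by
  classical
  rw [heard, Finset.mem_filter]

theorem mem_normalNbrs : j ∈ normalNbrs G N i ↔ j ∈ N ∧ G.Adj i j := by
  classical
  rw [normalNbrs, Finset.mem_filter]

theorem Timing.heard_eq_of_update (h : Timing N w τ U S t) (hc : Close N U S) (hi : i ∈ N)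
    (hflag : S.flag i = true) (hphase : S.phase i = 1 / 2) :
    heard G N U S i = normalNbrs G N i := by
  ext j
  rw [mem_heard, and_iff_left_iff_imp]
  intro hj
  exact h.fires_eq_of_update hc hi hflag hphase (mem_normalNbrs.1 hj).1

/-- A heard neighbour has lifted phase at least `U i + 1`, and `i` trails it by less than half a
turn. -/
theorem Timing.half_lt_of_heard (h : Timing N w τ U S t) (hc : Close N U S) (hi : i ∈ N)
    (hne : (heard G N U S i).Nonempty) (hflag : S.flag i = false) : 1 / 2 < S.phase i := by
  obtain ⟨j, hj⟩ := hne
  rw [mem_heard, mem_normalNbrs] at hj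
  have h1 := hc j hj.1.1 i hi
  have h2 := h.phase_nonneg j hj.1.1
  simp only [lift, hj.2] at h1
  simp only [fires, hflag, Bool.toNat_false, add_zero] at h1
  push_cast at h1
  linarith

theorem receive_eq_of_not_adj {u : V → ℝ} (h : ¬ G.Adj i j) :
    (S.receive G f j u).count i = S.count i ∧ (S.receive G f j u).vals i = S.vals i ∧
      (S.receive G f j u).zUp i = S.zUp i ∧ (S.receive G f j u).zLow i = S.zLow i := by
  simp [receive, h]

theorem Coherent.attack [Fintype V] (h : Coherent G N f w τ U S t) (hc : Close N U S)
    (hlocal : IsLocalAttack G N f) (u : V → ℝ)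
    (hcount : ∀ i ∈ N, (S.receive G f j u).count i ≤ inDegree G i) :
    Coherent G N f w τ U (S.receive G f j u) t where
  timing := ⟨h.1.1, h.1.2, h.1.3, h.1.4, h.1.5, h.1.6, h.1.7, h.1.8, h.1.9⟩
  pulses i hi := by
    have hheard : heard G N U (S.receive G f j u) i = heard G N U S i := rfl
    rw [hheard]
    by_cases hadj : G.Adj i j
    · refine (h.pulses i hi).receive hadj (Or.inl rfl) (fun l hl => ?_)
        (zero_le_one.trans (h.1.one_le_freq hi)) (h.1.phase_eq i hi) (h.1.phase_nonneg i hi)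
        (h.1.phase_le_one i hi) (h.1.phase_le_half i hi) (h.1.half_lt_of_heard hc hi)
        (fun h1 h2 => ?_) ?_
      · rw [mem_heard, mem_normalNbrs] at hl
        exact h.1.time_le i hi l hl.1.1 hl.2
      · rw [h.1.heard_eq_of_update hc hi h1 h2, inDegree_eq (N := N)]
        have : numFaulty G N i ≤ f := hlocal i hi
        omega
      · have := hcount i hi
        simpa [receive, hadj] using this
    · obtain ⟨h1, h2, h3, h4⟩ := receive_eq_of_not_adj (S := S) (f := f) (u := u) hadj
      exact (h.pulses i hi).mono le_rfl h2 h1 h3 h4 rfl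

open Classical in
/-- The state after the reset of the phase of the firing oscillator `j`, before the reception of
its pulse. -/
noncomputable def raise (S : OscState V) (j : V) : OscState V :=
  { S with phase := Function.update S.phase j 0, flag := Function.update S.flag j true }

theorem fires_raise (hflag : S.flag j = false) :
    fires U (S.raise j) j = fires U S j + 1 ∧ ∀ i ≠ j, fires U (S.raise j) i = fires U S i := by
  refine ⟨by simp [fires, raise, hflag], fun i hi => by simp [fires, raise, hi]⟩

/-- A firing trades phase `1` for one more completed firing. Hence lifted phases jump only at
updates. -/
theorem lift_raise (hflag : S.flag j = false) (hphase : S.phase j = 1) (i : V) :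
    lift U (S.raise j) i = lift U S i := by
  by_cases h : i = j
  · subst h
    rw [lift, (fires_raise hflag).1, lift, hphase]
    simp [raise]
  · rw [lift, (fires_raise hflag).2 i h, lift]
    simp [raise, h]

theorem Timing.roundTime_eq_of_fire (h : Timing N w τ U S t) (hc : Close N U S) (hj : j ∈ N)
    (hphase : S.phase j = 1) (hi : i ∈ N) : τ (U i) j = t := by
  obtain ⟨hflag, hround⟩ := h.round_eq_of_fire hc hj hphase
  have h1 := h.phase_eq j hj
  rw [hflag, hphase] at h1
  simp only [Bool.toNat_false, Nat.cast_zero, zero_add, left_eq_add, mul_eq_zero] at h1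
  have h2 := h.one_le_freq hj
  rw [hround i hi]
  rcases h1 with h1 | h1 <;> linarith

theorem Timing.raise (h : Timing N w τ U S t) (hc : Close N U S) (hj : j ∈ N)
    (hphase : S.phase j = 1) : Timing N w τ U (S.raise j) t := by
  obtain ⟨hflag, hround⟩ := h.round_eq_of_fire hc hj hphase
  obtain ⟨hf1, hf2⟩ := fires_raise (U := U) hflag
  have hfj : fires U S j = U j := by simp [fires, hflag]
  refine ⟨h.freq_eq, h.one_le, fun i hi => ?_, fun i hi => ?_, fun i hi => ?_, fun i hi => ?_,
    fun i hi l hl => ?_, fun i hi l hl => ?_, fun i hi l hl hil => ?_⟩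
  · have h1 := h.phase_eq i hi
    by_cases hij : i = j
    · subst hij
      rw [hflag, hphase] at h1
      simpa [OscState.raise] using h1
    · simpa [OscState.raise, hij] using h1
  · have h1 := h.phase_nonneg i hi
    by_cases hij : i = j
    · subst hij; simp [OscState.raise]
    · simpa [OscState.raise, hij] using h1
  · have h1 := h.phase_le_one i hi
    by_cases hij : i = j
    · subst hij; simp [OscState.raise]
    · simpa [OscState.raise, hij] using h1
  · have h1 := h.phase_le_half i hi
    by_cases hij : i = j
    · subst hij; simp [OscState.raise]
    · simpa [OscState.raise, hij] using h1
  · have h1 := h.round_le i hi l hl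
    by_cases hlj : l = j
    · subst hlj; omega
    · rwa [hf2 l hlj]
  · have h1 := h.le_round i hi l hl
    by_cases hlj : l = j
    · subst hlj; have := hround i hi; omega
    · rwa [hf2 l hlj]
  · by_cases hlj : l = j
    · subst hlj; exact (h.roundTime_eq_of_fire hc hj hphase hi).le
    · exact h.time_le i hi l hl (by rwa [hf2 l hlj] at hil)

/-- All normal oscillators are in the round of `j` when it fires. So each normal receiver hears `j`
for the first time in its round, and the pulse carries `w (U i) j` at time `τ (U i) j`. -/
theorem Coherent.fire [Fintype V] (h : Coherent G N f w τ U S t) (hc : Close N U S)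
    (hlocal : IsLocalAttack G N f) (hj : j ∈ N) (hphase : S.phase j = 1)
    (hcount : ∀ i ∈ N, (S.fire G f j).count i ≤ inDegree G i) :
    Coherent G N f w τ U (S.fire G f j) t := by
  classical
  obtain ⟨hflag, hround⟩ := h.1.round_eq_of_fire hc hj hphase
  obtain ⟨hf1, hf2⟩ := fires_raise (U := U) hflag
  have hfj : fires U S j = U j := by simp [fires, hflag]
  have hT := h.1.raise hc hj hphase
  have hc' : Close N U (S.raise j) := by
    intro i hi l hl
    rw [lift_raise hflag hphase, lift_raise hflag hphase]
    exact hc i hi l hl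
  have hfire : S.fire G f j = (S.raise j).receive G f j fun _ => S.freq j := rfl
  rw [hfire] at hcount ⊢
  refine ⟨⟨hT.1, hT.2, hT.3, hT.4, hT.5, hT.6, hT.7, hT.8, hT.9⟩, fun i hi => ?_⟩
  have hheard : heard G N U ((S.raise j).receive G f j fun _ => S.freq j) i =
      heard G N U (S.raise j) i := rfl
  rw [hheard]
  have hjnot : j ∉ heard G N U S i := by
    rw [mem_heard]
    rintro ⟨-, h1⟩
    have := hround i hi
    omega
  have hp : Pulses f (inDegree G i) (heard G N U S i) (w (U i)) (τ (U i)) t (S.raise j) i :=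
    (h.pulses i hi).mono le_rfl rfl rfl rfl rfl rfl
  by_cases hadj : G.Adj i j
  · have hins : heard G N U (S.raise j) i = insert j (heard G N U S i) := by
      ext l
      rw [mem_heard, Finset.mem_insert, mem_heard]
      by_cases hl : l = j
      · subst hl
        have h1 : l ∈ normalNbrs G N i := mem_normalNbrs.2 ⟨hj, hadj⟩
        have h2 := hround i hi
        simp only [h1, true_and, true_or, iff_true]
        omega
      · rw [hf2 l hl]; simp [hl]
    refine hp.receive hadj (Or.inr ⟨hjnot, hins, ?_, ?_⟩) (fun l hl => ?_)
      (zero_le_one.trans (hT.one_le_freq hi)) (hT.phase_eq i hi) (hT.phase_nonneg i hi)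
      (hT.phase_le_one i hi) (hT.phase_le_half i hi) (hT.half_lt_of_heard hc' hi)
      (fun h1 h2 => ?_) ?_
    · rw [h.1.freq_eq j hj, hround i hi]
    · exact h.1.roundTime_eq_of_fire hc hj hphase hi
    · rw [mem_heard, mem_normalNbrs] at hl
      exact hT.time_le i hi l hl.1.1 hl.2
    · have hij : i ≠ j := by
        rintro rfl
        simp [raise] at h2
      simp only [raise, Function.update_of_ne hij] at h1 h2
      rw [h.1.heard_eq_of_update hc hi h1 h2, inDegree_eq (N := N)]
      have : numFaulty G N i ≤ f := hlocal i hi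
      omega
    · have := hcount i hi
      simpa [receive, hadj] using this
  · obtain ⟨h1, h2, h3, h4⟩ := receive_eq_of_not_adj (S := S.raise j) (f := f)
      (u := fun _ => S.freq j) hadj
    have hsame : heard G N U (S.raise j) i = heard G N U S i := by
      ext l
      rw [mem_heard, mem_heard]
      by_cases hl : l = j
      · subst hl
        have h1 : l ∉ normalNbrs G N i := fun h => hadj (mem_normalNbrs.1 h).2
        simp [h1]
      · rw [hf2 l hl]
    rw [hsame]
    exact hp.mono le_rfl h2 h1 h3 h4 rfl

/-- The effect of an update on the phase and the frequency, in terms of consensus steps. -/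
theorem Coherent.update_steps [Fintype V] (h : Coherent G N f w τ U S t) (hc : Close N U S)
    (hlocal : IsLocalAttack G N f) (hrobust : IsRobust G (2 * f + 1)) (hα : 0 ≤ α) (hi : i ∈ N)
    (hflag : S.flag i = true) (hphase : S.phase i = 1 / 2) (hcount : S.count i ≤ inDegree G i)
    (hup : S.IsUpdate G f α i S') :
    α ≤ 1 ∧ ConsensusStep G N f α 0 (w (U i)) i (S'.freq i) ∧
    |S'.phase i - 1 / 2| ≤ 1 / 4 ∧
    (∃ y, S'.phase i = 1 / 2 + S.freq i * (τ (U i) i - y) ∧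
      ConsensusStep G N f (1 / 2) 0 (τ (U i)) i y) ∧
    S' = reset S i (S'.phase i) (S'.freq i) := by
  have hp := h.pulses i hi
  rw [h.1.heard_eq_of_update hc hi hflag hphase] at hp
  rcases hup with ⟨h1, -⟩ | ⟨-, ω, hω, rfl⟩
  · omega
  have hf : (S.reset i (S.phase i + (S.zUp i + S.zLow i) / 2) ω).freq i = ω := by simp [reset]
  have hph : (S.reset i (S.phase i + (S.zUp i + S.zLow i) / 2) ω).phase i =
      S.phase i + (S.zUp i + S.zLow i) / 2 := by simp [reset]
  obtain ⟨Ms, hv1, hv2⟩ := hp.vals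
  rw [hf, hph]
  refine ⟨hω.le_one hα, hω.consensusStep hα (h.1.freq_eq i hi) hi hv1 hv2 hcount (hlocal i hi),
    ?_, ?_, rfl⟩
  · have h1 := hp.zUp_mem
    have h2 := hp.zLow_mem
    rw [hphase, abs_le]
    constructor <;> linarith [h1.1, h1.2, h2.1, h2.2]
  · obtain ⟨y, hy, hy'⟩ := hp.consensusStep hi hcount (hlocal i hi) (inDegree_dichotomy hrobust i)
    exact ⟨y, by rw [hphase, hy]; ring, hy'⟩

-- The raised update number and the lowered flag cancel in `fires`, so the other oscillators notice
-- nothing. Everybody has fired in the old round, so `i` starts the new one with nobody heard.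
open Classical in
theorem Coherent.update (h : Coherent G N f w τ U S t) (hc : Close N U S) (hi : i ∈ N)
    (hflag : S.flag i = true) (hphase : S.phase i = 1 / 2) {p ω : ℝ}
    (hstep : ConsensusStep G N f α 0 (w (U i)) i ω) (hp : |p - 1 / 2| ≤ 1 / 4)
    (hω : w (U i + 1) i = ω) (hτ : τ (U i + 1) i = t + (1 - p) / ω) :
    Coherent G N f w τ (Function.update U i (U i + 1)) (reset S i p ω) t := by
  set U' := Function.update U i (U i + 1) with hU'
  set S' := reset S i p ω with hS'
  have hp' := abs_le.1 hp
  have hUi : U' i = U i + 1 := by simp [hU']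
  have hUj : ∀ j ≠ i, U' j = U j := fun j hj => by simp [hU', hj]
  have hfires : ∀ j, fires U' S' j = fires U S j := by
    intro j
    by_cases hj : j = i
    · subst hj; simp [fires, hUi, hS', reset, hflag]
    · simp [fires, hUj j hj, hS', reset, hj]
  have hready : ∀ j ∈ N, fires U S j = U i + 1 := fun j hj =>
    h.1.fires_eq_of_update hc hi hflag hphase hj
  have hone : 1 ≤ ω := by
    have := hstep.ge_of_bound hi (m := 1) (fun j hj => h.1.one_le j hj _ (by
      have h1 := hready j hj
      have h2 : (S.flag j).toNat ≤ 1 := Bool.toNat_le _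
      simp only [fires] at h1
      omega))
    linarith
  refine ⟨⟨fun j hj => ?_, fun j hj q hq => ?_, fun j hj => ?_, fun j hj => ?_, fun j hj => ?_,
    fun j hj => ?_, fun j hj l hl => ?_, fun j hj l hl => ?_, fun j hj l hl hjl => ?_⟩,
    fun j hj => ?_⟩
  · by_cases hji : j = i
    · subst hji; rw [hUi, hω]; simp [hS', reset]
    · rw [hUj j hji, ← h.1.freq_eq j hj]; simp [hS', reset, hji]
  · by_cases hji : j = i
    · subst hji
      rw [hUi] at hq
      rcases Nat.lt_or_ge (U j) q with hq' | hq'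
      · have : q = U j + 1 := by omega
        rw [this, hω]; exact hone
      · exact h.1.one_le j hj q hq'
    · exact h.1.one_le j hj q (hUj j hji ▸ hq)
  · by_cases hji : j = i
    · subst hji
      rw [hUi, hτ]
      simp only [hS', reset, Function.update_self, Bool.toNat_false]
      field_simp
      push_cast; ring
    · rw [hUj j hji]
      have := h.1.phase_eq j hj
      simpa [hS', reset, hji] using this
  · by_cases hji : j = i
    · subst hji
      simp only [hS', reset, Function.update_self]; linarith
    · have := h.1.phase_nonneg j hj
      simpa [hS', reset, hji] using this
  · by_cases hji : j = i
    · subst hji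
      simp only [hS', reset, Function.update_self]; linarith
    · have := h.1.phase_le_one j hj
      simpa [hS', reset, hji] using this
  · by_cases hji : j = i
    · subst hji
      simp [hS', reset]
    · have := h.1.phase_le_half j hj
      simpa [hS', reset, hji] using this
  · rw [hfires]
    by_cases hji : j = i
    · subst hji; rw [hUi, hready l hl]
    · rw [hUj j hji]; exact h.1.round_le j hj l hl
  · rw [hfires]
    by_cases hji : j = i
    · subst hji; rw [hUi, hready l hl]; omega
    · rw [hUj j hji]; exact h.1.le_round j hj l hl
  · rw [hfires] at hjl
    by_cases hji : j = i
    · subst hji; rw [hUi, hready l hl] at hjl; omega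
    · rw [hUj j hji] at hjl ⊢; exact h.1.time_le j hj l hl hjl
  · by_cases hji : j = i
    · subst hji
      have hempty : heard G N U' S' j = ∅ := by
        ext l
        rw [mem_heard, hfires, hUi]
        simp only [Finset.notMem_empty, iff_false, not_and, mem_normalNbrs]
        intro hl
        rw [hready l hl.1]; omega
      rw [hempty]
      have hc0 : S'.count j = 0 := by simp [hS', reset]
      have hpj := h.pulses j hj
      -- The corrections are not reset. Their old values need only satisfy the bounds, because the
      -- threshold clauses are vacuous while the counter is `0`.
      exact ⟨⟨0, by simp [hS', reset], by simp [hc0]⟩, hpj.zUp_mem, hpj.zLow_mem,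
        fun _ h1 _ => by omega, fun _ h1 _ => by omega, hpj.z_zero⟩
    · have hsame : heard G N U' S' j = heard G N U S j := by
        ext l
        rw [mem_heard, mem_heard, hfires, hUj j hji]
      rw [hsame, hUj j hji]
      refine (h.pulses j hj).mono le_rfl ?_ ?_ rfl rfl ?_ <;> simp [hS', reset, hji]

end OscState

/-! ### The phase envelope and the invariant that keeps the phases within half a turn. -/

namespace OscState

variable {V : Type*} {G : Digraph V} {N : Finset V} {f : ℕ} {α : ℝ}
  {w τ : ℕ → V → ℝ} {U : V → ℕ} {S S' : OscState V} {t A B : ℝ} {i j : V}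

/-- All lifted normal phases, and all those that can be reached by the corrections that are
possible in the current rounds, lie in `[B, A]`. -/
structure Envelope (N : Finset V) (τ : ℕ → V → ℝ) (U : V → ℕ) (S : OscState V) (t A B : ℝ) :
    Prop where
  lift_mem : ∀ i ∈ N, lift U S i ∈ Set.Icc B A
  -- This is the lifted phase that `i` would have, had it fired together with `j`.
  pending_mem : ∀ i ∈ N, ∀ j ∈ N, fires U S j = U i + 1 →
    U i + 1 + S.freq i * (t - τ (U i) j) ∈ Set.Icc B A

theorem Envelope.close (h : Envelope N τ U S t A B) (hAB : A - B < 1 / 2) : Close N U S := by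
  intro i hi j hj
  have h1 := (h.lift_mem i hi).2
  have h2 := (h.lift_mem j hj).1
  linarith

theorem Envelope.flow (h : Envelope N τ U S t A B) {r lo hi : ℝ} (hr : 0 ≤ r)
    (hlo : ∀ i ∈ N, lo ≤ S.freq i) (hhi : ∀ i ∈ N, S.freq i ≤ hi) :
    Envelope N τ U (S.flow r) (t + r) (A + r * hi) (B + r * lo) := by
  have key : ∀ i ∈ N, r * lo ≤ r * S.freq i ∧ r * S.freq i ≤ r * hi := fun i hi =>
    ⟨mul_le_mul_of_nonneg_left (hlo i hi) hr, mul_le_mul_of_nonneg_left (hhi i hi) hr⟩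
  refine ⟨fun i hi => ?_, fun i hi j hj hij => ?_⟩
  · have h1 := h.lift_mem i hi
    have h2 := key i hi
    have h3 : lift U (S.flow r) i = lift U S i + r * S.freq i := by
      simp only [lift, fires, OscState.flow]; ring
    rw [h3]
    exact ⟨by linarith [h1.1], by linarith [h1.2]⟩
  · have h1 := h.pending_mem i hi j hj hij
    have h2 := key i hi
    have h3 : U i + 1 + (S.flow r).freq i * (t + r - τ (U i) j) =
        U i + 1 + S.freq i * (t - τ (U i) j) + r * S.freq i := by
      simp only [OscState.flow]; ring
    rw [h3]
    exact ⟨by linarith [h1.1], by linarith [h1.2]⟩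

theorem Envelope.fire (h : Envelope N τ U S t A B) (hT : Timing N w τ U S t) (hc : Close N U S)
    (hj : j ∈ N) (hphase : S.phase j = 1) : Envelope N τ U (S.fire G f j) t A B := by
  obtain ⟨hflag, hround⟩ := hT.round_eq_of_fire hc hj hphase
  obtain ⟨hf1, hf2⟩ := fires_raise (U := U) hflag
  refine ⟨fun i hi => ?_, fun i hi l hl hil => ?_⟩
  · have h1 : lift U (S.fire G f j) i = lift U (S.raise j) i := rfl
    rw [h1, lift_raise hflag hphase]
    exact h.lift_mem i hi
  · have h1 : fires U (S.fire G f j) l = fires U (S.raise j) l := rfl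
    rw [h1] at hil
    by_cases hlj : l = j
    · subst hlj
      have h2 := h.lift_mem l hl
      have h3 : lift U S l = U i + 1 := by
        rw [lift, hphase, fires, hflag, hround i hi]; simp
      rw [hT.roundTime_eq_of_fire hc hj hphase hi]
      rw [h3] at h2
      simpa using h2
    · rw [hf2 l hlj] at hil
      exact h.pending_mem i hi l hl hil

-- The update moves `i` to `U i + 1 + S.freq i * (t - y)` with `y` in the hull of the normal firing
-- times of the round. For `y` equal to any of these firing times the value lies in `[B, A]` by
-- `pending_mem`, and the expression is affine in `y`. So updates do not enlarge the envelope.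
open Classical in
theorem Envelope.update (h : Envelope N τ U S t A B) (hT : Timing N w τ U S t)
    (hc : Close N U S) (hi : i ∈ N) (hflag : S.flag i = true) (hphase : S.phase i = 1 / 2)
    {p ω y : ℝ} (hp : p = 1 / 2 + S.freq i * (τ (U i) i - y))
    (hy : ConsensusStep G N f (1 / 2) 0 (τ (U i)) i y) :
    Envelope N τ (Function.update U i (U i + 1)) (reset S i p ω) t A B := by
  have hready : ∀ j ∈ N, fires U S j = U i + 1 := fun j hj =>
    hT.fires_eq_of_update hc hi hflag hphase hj
  have hfires : ∀ j, fires (Function.update U i (U i + 1)) (reset S i p ω) j = fires U S j := by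
    intro j
    by_cases hj : j = i
    · subst hj; simp [fires, reset, hflag]
    · simp [fires, reset, hj]
  have hω := hT.one_le_freq hi
  have hω0 : 0 < S.freq i := by linarith
  refine ⟨fun j hj => ?_, fun j hj l hl hjl => ?_⟩
  · by_cases hji : j = i
    · subst hji
      have h0 := hT.phase_eq j hj
      rw [hflag, hphase] at h0
      simp only [Bool.toNat_true, Nat.cast_one] at h0
      have h1 : lift (Function.update U j (U j + 1)) (reset S j p ω) j =
          U j + 1 + S.freq j * (t - y) := by
        rw [lift, hfires, hready j hj, hp]
        simp only [reset, Function.update_self]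
        push_cast
        linarith
      have hle : y ≤ t + (U j + 1 - B) / S.freq j + 0 := hy.le_of_bound hj fun l hl => by
        have h2 := (h.pending_mem j hj l hl (hready l hl)).1
        rw [← sub_le_iff_le_add', le_div_iff₀ hω0]
        linarith
      have hge : t - (A - U j - 1) / S.freq j - 0 ≤ y := hy.ge_of_bound hj fun l hl => by
        have h2 := (h.pending_mem j hj l hl (hready l hl)).2
        rw [sub_le_comm, le_div_iff₀ hω0]
        linarith
      rw [add_zero, ← sub_le_iff_le_add', le_div_iff₀ hω0] at hle
      rw [sub_zero, sub_le_comm, le_div_iff₀ hω0] at hge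
      rw [h1]
      exact ⟨by linarith, by linarith⟩
    · have h1 : lift (Function.update U i (U i + 1)) (reset S i p ω) j = lift U S j := by
        rw [lift, hfires, lift]; simp [reset, hji]
      rw [h1]
      exact h.lift_mem j hj
  · rw [hfires] at hjl
    by_cases hji : j = i
    · subst hji
      rw [Function.update_self, hready l hl] at hjl
      omega
    · rw [Function.update_of_ne hji] at hjl ⊢
      have h1 : (reset S i p ω).freq j = S.freq j := by simp [reset, hji]
      rw [h1]
      exact h.pending_mem j hj l hl hjl

/-- The invariant of a run. Here `D` bounds the initial width of the phases. -/
structure Invariant (G : Digraph V) (N : Finset V) (f : ℕ) (α : ℝ) (w τ : ℕ → V → ℝ) (D : ℝ)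
    (U : V → ℕ) (S : OscState V) (t : ℝ) : Prop where
  coherent : Coherent G N f w τ U S t
  freq_step : ∀ i ∈ N, ∀ q < U i, ConsensusStep G N f α 0 (w q) i (w (q + 1) i)
  envelope : ∃ A B : ℝ, ∃ p : ℕ, Envelope N τ U S t A B ∧ (∀ i ∈ N, p ≤ U i) ∧
    (∃ i ∈ N, U i = p) ∧
    -- `p` is the round of the slowest oscillator, and `p + 3 / 2` bounds its lifted phase and hence
    -- `B`. The left side is the width now plus the widening still possible in round `p`: the
    -- envelope widens at rate at most `width N (w p)` while `B` rises at rate at least `1`. Each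
    -- new round adds one summand on the right.
    A - B + width N (w p) * (p + 3 / 2 - B) ≤
      D + width N (w 0) / 2 + ∑ q ∈ Finset.range (p + 1), width N (w q)

theorem width_succ_le {q : ℕ} (hN : N.Nonempty)
    (h : ∀ i ∈ N, ConsensusStep G N f α 0 (w q) i (w (q + 1) i)) :
    width N (w (q + 1)) ≤ width N (w q) := by
  refine width_le hN (fun i hi => ?_) (fun i hi => ?_)
  · have := (h i hi).ge_of_bound hi fun j hj => hull_inf_le hj
    linarith
  · have := (h i hi).le_of_bound hi fun j hj => le_hull_sup hj
    linarith

/-- The total frequency width over all rounds. -/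
theorem sum_width_le (hN : N.Nonempty) (hrobust : IsRobust G (2 * f + 1)) (hα : 0 < α)
    (hα1 : α ≤ 1) {p : ℕ}
    (h : ∀ i ∈ N, ∀ q < p, ConsensusStep G N f α 0 (w q) i (w (q + 1) i)) :
    ∑ q ∈ Finset.range (p + 1), width N (w q) ≤
      2 * N.card / α ^ N.card * width N (w 0) := by
  have hpow : 0 < α ^ N.card := by positivity
  have hpow1 : α ^ N.card ≤ 1 := pow_le_one₀ hα.le hα1
  have := sum_le_of_contraction (δ := fun q => width N (w q)) (κ := 1 - α ^ N.card / 2)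
    (n := N.card) (p := p) (by linarith) (by linarith) hN.card_pos (fun q => width_nonneg hN)
    (fun q hq => width_succ_le hN fun i hi => h i hi q hq) (fun q hq => by
      have := width_contraction hN hrobust hα hα1 le_rfl (v := w) (c := fun _ => 0) (a := q)
        (n := N.card) (fun r hr hr' i hi => by simpa using h i hi r (by omega)) (by omega)
      linarith)
  refine this.trans (le_of_eq ?_)
  rw [sub_sub_cancel]
  field_simp

/-- The hypotheses on the data under which the invariant is preserved. -/
structure Admissible (G : Digraph V) (N : Finset V) (f : ℕ) (α : ℝ) (w : ℕ → V → ℝ) (D : ℝ) :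
    Prop where
  nonempty : N.Nonempty
  robust : IsRobust G (2 * f + 1)
  isLocal : IsLocalAttack G N f
  pos : 0 < α
  le_one : α ≤ 1
  budget : D + width N (w 0) / 2 + 2 * N.card / α ^ N.card * width N (w 0) < 1 / 2

variable {D : ℝ}

/-- The frequencies in use lie in the hull of those of the slowest round. -/
theorem Invariant.freq_mem_hull (h : Invariant G N f α w τ D U S t) {p : ℕ}
    (hp : ∀ i ∈ N, p ≤ U i) (hp' : ∃ i ∈ N, U i = p) (hi : i ∈ N) :
    S.freq i ∈ Set.Icc (⨅ j : N, w p j) (⨆ j : N, w p j) := by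
  obtain ⟨l, hl, rfl⟩ := hp'
  have h1 := h.coherent.timing.le_round l hl i hi
  have h2 := hp i hi
  have h3 : U i = U l ∨ U i = U l + 1 := by
    have : U i ≤ fires U S i := Nat.le_add_right _ _
    omega
  rw [h.coherent.timing.freq_eq i hi]
  rcases h3 with h3 | h3
  · rw [h3]; exact ⟨hull_inf_le hi, le_hull_sup hi⟩
  · have h4 := h.freq_step i hi (U l) (by omega)
    rw [h3]
    refine ⟨?_, ?_⟩
    · have := h4.ge_of_bound hi fun j hj => hull_inf_le hj
      linarith
    · have := h4.le_of_bound hi fun j hj => le_hull_sup hj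
      linarith

theorem Envelope.base_le (h : Envelope N τ U S t A B) (hT : Timing N w τ U S t) (hi : i ∈ N) :
    B ≤ U i + 3 / 2 := (h.lift_mem i hi).1.trans (hT.lift_le hi)

/-- The future widening in the envelope bound is nonnegative, so `A - B` alone is below the budget
`1 / 2`. -/
theorem Invariant.close (h : Invariant G N f α w τ D U S t) (hadm : Admissible G N f α w D) :
    Close N U S := by
  obtain ⟨A, B, p, hE, hp, ⟨i, hi, hip⟩, hw⟩ := h.envelope
  refine hE.close ?_
  have h1 := hE.base_le h.coherent.timing hi
  rw [hip] at h1
  have h2 : 0 ≤ width N (w p) * (p + 3 / 2 - B) :=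
    mul_nonneg (width_nonneg hadm.nonempty) (by linarith)
  have h3 := sum_width_le hadm.nonempty hadm.robust hadm.pos hadm.le_one (w := w) (p := p)
    (fun i hi q hq => h.freq_step i hi q (hq.trans_le (hp i hi)))
  linarith [hadm.budget]

theorem Invariant.flow (h : Invariant G N f α w τ D U S t) (hN : N.Nonempty) {r : ℝ}
    (hr : S.CanFlow N r) : Invariant G N f α w τ D U (S.flow r) (t + r) := by
  refine ⟨h.coherent.flow hr, h.freq_step, ?_⟩
  obtain ⟨A, B, p, hE, hp, hp', hw⟩ := h.envelope
  have hfreq := fun i hi => h.freq_mem_hull (i := i) hp hp' hi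
  refine ⟨_, _, p, hE.flow hr.1 (fun i hi => (hfreq i hi).1) (fun i hi => (hfreq i hi).2),
    hp, hp', ?_⟩
  have h1 : 1 ≤ ⨅ j : N, w p j :=
    le_hull_inf hN fun i hi => h.coherent.timing.one_le i hi p (hp i hi)
  have h2 : r * width N (w p) = r * (⨆ j : N, w p j) - r * ⨅ j : N, w p j := by
    rw [width]; ring
  -- `A - B` grows by `r * width N (w p)`, and the rise of `B` by at least `r` pays for it.
  have h3 : width N (w p) * r ≤ width N (w p) * (r * ⨅ j : N, w p j) :=
    mul_le_mul_of_nonneg_left (le_mul_of_one_le_right hr.1 h1) (width_nonneg hN)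
  linarith

theorem Invariant.attack [Fintype V] (h : Invariant G N f α w τ D U S t)
    (hadm : Admissible G N f α w D) (u : V → ℝ)
    (hcount : ∀ i ∈ N, (S.receive G f j u).count i ≤ inDegree G i) :
    Invariant G N f α w τ D U (S.receive G f j u) t := by
  refine ⟨h.coherent.attack (h.close hadm) hadm.isLocal u hcount, h.freq_step, ?_⟩
  obtain ⟨A, B, p, hE, hp, hp', hw⟩ := h.envelope
  exact ⟨A, B, p, ⟨hE.1, hE.2⟩, hp, hp', hw⟩

theorem Invariant.fire [Fintype V] (h : Invariant G N f α w τ D U S t)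
    (hadm : Admissible G N f α w D) (hj : j ∈ N) (hphase : S.phase j = 1)
    (hcount : ∀ i ∈ N, (S.fire G f j).count i ≤ inDegree G i) :
    Invariant G N f α w τ D U (S.fire G f j) t := by
  have hc := h.close hadm
  refine ⟨h.coherent.fire hc hadm.isLocal hj hphase hcount, h.freq_step, ?_⟩
  obtain ⟨A, B, p, hE, hp, hp', hw⟩ := h.envelope
  exact ⟨A, B, p, hE.fire h.coherent.timing hc hj hphase, hp, hp', hw⟩

open Classical in
theorem Invariant.update [Fintype V] (h : Invariant G N f α w τ D U S t)
    (hadm : Admissible G N f α w D) (hi : i ∈ N) (hflag : S.flag i = true)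
    (hphase : S.phase i = 1 / 2) (hcount : S.count i ≤ inDegree G i)
    (hup : S.IsUpdate G f α i S') (hw : w (U i + 1) i = S'.freq i)
    (hτ : τ (U i + 1) i = t + (1 - S'.phase i) / S'.freq i) :
    Invariant G N f α w τ D (Function.update U i (U i + 1)) S' t := by
  have hc := h.close hadm
  obtain ⟨-, h1, h2, ⟨y, hy, hy'⟩, h3⟩ := h.coherent.update_steps hc hadm.isLocal hadm.robust
    hadm.pos.le hi hflag hphase hcount hup
  have hstep : ∀ j ∈ N, ∀ q < Function.update U i (U i + 1) j,
      ConsensusStep G N f α 0 (w q) j (w (q + 1) j) := by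
    intro j hj q hq
    by_cases hji : j = i
    · subst hji
      rw [Function.update_self] at hq
      rcases Nat.lt_or_ge q (U j) with hq' | hq'
      · exact h.freq_step j hj q hq'
      · have : q = U j := by omega
        rw [this, hw]; exact h1
    · rw [Function.update_of_ne hji] at hq
      exact h.freq_step j hj q hq
  have hcoh : Coherent G N f w τ (Function.update U i (U i + 1)) S' t := by
    rw [h3]; exact h.coherent.update hc hi hflag hphase h1 h2 hw hτ
  refine ⟨hcoh, hstep, ?_⟩
  obtain ⟨A, B, p, hE, hp, ⟨l, hl, hlp⟩, hwd⟩ := h.envelope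
  have hE' : Envelope N τ (Function.update U i (U i + 1)) S' t A B := by
    rw [h3]; exact hE.update h.coherent.timing hc hi hflag hphase hy hy'
  have hge : ∀ j ∈ N, p ≤ Function.update U i (U i + 1) j := by
    intro j hj
    by_cases hji : j = i
    · subst hji; rw [Function.update_self]; exact (hp j hj).trans (Nat.le_succ _)
    · rw [Function.update_of_ne hji]; exact hp j hj
  by_cases hex : ∃ j ∈ N, Function.update U i (U i + 1) j = p
  · exact ⟨A, B, p, hE', hge, hex, hwd⟩
  · have hli : l = i := by
      by_contra hli
      exact hex ⟨l, hl, by rw [Function.update_of_ne hli, hlp]⟩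
    subst hli
    refine ⟨A, B, p + 1, hE', fun j hj => ?_, ⟨l, hl, by rw [Function.update_self, hlp]⟩, ?_⟩
    · have h4 := hge j hj
      have h5 : Function.update U l (U l + 1) j ≠ p := fun h => hex ⟨j, hj, h⟩
      omega
    -- The slowest oscillator enters round `p + 1`, so the bound on `B` rises by `1`; the new
    -- summand `width N (w (p + 1))` pays for this.
    · rw [Finset.sum_range_succ]
      have h4 : width N (w (p + 1)) ≤ width N (w p) :=
        width_succ_le hadm.nonempty fun j hj => hstep j hj p (by
          have h4 := hge j hj
          have h5 : Function.update U l (U l + 1) j ≠ p := fun h => hex ⟨j, hj, h⟩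
          omega)
      have h5 := hE.base_le h.coherent.timing hl
      rw [hlp] at h5
      have h6 : width N (w (p + 1)) * (p + 3 / 2 - B) ≤ width N (w p) * (p + 3 / 2 - B) :=
        mul_le_mul_of_nonneg_right h4 (by linarith)
      push_cast
      linarith

end OscState

/-! ### The rounds of an execution and the invariant along a run. -/

namespace Execution

variable {V : Type*} {G : Digraph V} {N : Finset V} {f : ℕ} {α : ℝ} {X : Execution V}

open Classical in
/-- The number of updates of `i` among the first `k` events. -/
noncomputable def updates (X : Execution V) : ℕ → V → ℕ
  | 0 => fun _ => 0
  | k + 1 => fun i => updates X k i + if X.event k = .update i then 1 else 0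

/-- The first index at which `i` has made `q` updates. -/
noncomputable def firstIndex (X : Execution V) (q : ℕ) (i : V) : ℕ :=
  sInf {k | q ≤ X.updates k i}

/-- The frequency of `i` after its `q`-th update. -/
noncomputable def roundFreq (X : Execution V) (q : ℕ) (i : V) : ℝ :=
  (X.state (X.firstIndex q i)).freq i

/-- The time at which `i`, after its `q`-th update, is going to fire. -/
noncomputable def roundTime (X : Execution V) (q : ℕ) (i : V) : ℝ :=
  X.time (X.firstIndex q i) +
    (1 - (X.state (X.firstIndex q i)).phase i) / (X.state (X.firstIndex q i)).freq i

theorem updates_mono (X : Execution V) (i : V) : Monotone fun k => X.updates k i :=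
  monotone_nat_of_le_succ fun _ => Nat.le_add_right _ _

theorem firstIndex_zero (X : Execution V) (i : V) : X.firstIndex 0 i = 0 := by
  simp [firstIndex]

open Classical in
theorem updates_succ_of_update {k : ℕ} {i : V} (h : X.event k = .update i) :
    X.updates (k + 1) = Function.update (X.updates k) i (X.updates k i + 1) := by
  funext j
  by_cases hj : j = i
  · subst hj; simp [updates, h]
  · simp [updates, h, hj, Ne.symm hj]

theorem updates_succ_of_ne {k : ℕ} {i : V} (h : X.event k ≠ .update i) :
    X.updates (k + 1) i = X.updates k i := by
  simp [updates, h]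

theorem firstIndex_of_update {k : ℕ} {i : V} (h : X.event k = .update i) :
    X.firstIndex (X.updates k i + 1) i = k + 1 := by
  have h1 : X.updates (k + 1) i = X.updates k i + 1 := by simp [updates, h]
  refine le_antisymm (Nat.sInf_le h1.ge) (le_csInf ⟨k + 1, h1.ge⟩ fun l hl => ?_)
  by_contra hcon
  have := X.updates_mono i (show l ≤ k by omega)
  have h2 : X.updates k i + 1 ≤ X.updates l i := hl
  simp only at this
  omega

namespace IsRun

theorem nonempty (h : X.IsRun G N f α) : N.Nonempty := by
  have := h.isEvent 0
  cases he : X.event 0 with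
  | fire i => rw [he] at this; exact ⟨i, this.1⟩
  | update i => rw [he] at this; exact ⟨i, this.1⟩
  | attack j v => rw [he] at this; obtain ⟨-, ⟨i, hi, -⟩, -⟩ := this; exact ⟨i, hi⟩

theorem time_mono (h : X.IsRun G N f α) : Monotone X.time :=
  monotone_nat_of_le_succ fun k => sub_nonneg.1 (h.canFlow k).1

/-- Counters and flags are bounded, so that not all events are firings and attacks. -/
theorem exists_update (h : X.IsRun G N f α) (hst : X.IsStealthy G N) :
    ∃ k, ∃ i ∈ N, X.event k = .update i := by
  classical
  by_contra! hcon
  -- Without updates every event raises a flag or a counter of a normal oscillator, so their sum is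
  -- at least the number of events, while stealthiness bounds it.
  have key : ∀ k, (∀ i ∈ N, (X.state k).flag i = true → (X.state k).phase i ≤ 1 / 2) ∧
      k ≤ ∑ i ∈ N, (((X.state k).flag i).toNat + (X.state k).count i) := by
    intro k
    induction k with
    | zero =>
      refine ⟨fun i hi hf => ?_, Nat.zero_le _⟩
      rw [h.flag_zero i hi] at hf
      exact absurd hf (by simp)
    | succ k ih =>
      obtain ⟨ih1, ih2⟩ := ih
      have hev := h.isEvent k
      have hfl := (h.canFlow k).2
      cases he : X.event k with
      | update i =>
        rw [he] at hev
        exact absurd he (hcon k i hev.1)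
      | fire j =>
        rw [he] at hev
        obtain ⟨hj, hph, hs⟩ := hev
        have hflag : (X.state k).flag j = false := by
          by_contra hf
          have hf' : (X.state k).flag j = true := by simpa using hf
          have := (hfl j hj).2 hf' (ih1 j hj hf')
          simp only [OscState.flow] at hph
          linarith
        rw [hs]
        refine ⟨fun i hi hf => ?_, ?_⟩
        · by_cases hij : i = j
          · subst hij; simp [OscState.fire, OscState.receive]
          · simp only [OscState.fire, OscState.receive, OscState.flow,
              Function.update_of_ne hij] at hf ⊢
            exact (hfl i hi).2 hf (ih1 i hi hf)
        · have hle : ∀ i ∈ N, ((X.state k).flag i).toNat + (X.state k).count i ≤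
              ((((X.state k).flow (X.time (k + 1) - X.time k)).fire G f j).flag i).toNat +
              (((X.state k).flow (X.time (k + 1) - X.time k)).fire G f j).count i := by
            intro i hi
            refine Nat.add_le_add ?_ ?_
            · by_cases hij : i = j
              · subst hij; simp [OscState.fire, OscState.receive, Bool.toNat_le]
              · simp [OscState.fire, OscState.receive, OscState.flow, hij]
            · simp only [OscState.fire, OscState.receive, OscState.flow]
              split_ifs <;> omega
          have hlt := Finset.sum_lt_sum hle ⟨j, hj, by
            refine Nat.add_lt_add_of_lt_of_le ?_ ?_
            · simp [OscState.fire, OscState.receive, hflag]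
            · simp only [OscState.fire, OscState.receive, OscState.flow]
              split_ifs <;> omega⟩
          omega
      | attack j v =>
        rw [he] at hev
        obtain ⟨hj, ⟨l, hl, hadj⟩, hs⟩ := hev
        rw [hs]
        refine ⟨fun i hi hf => (hfl i hi).2 hf (ih1 i hi hf), ?_⟩
        have hle : ∀ i ∈ N, ((X.state k).flag i).toNat + (X.state k).count i ≤
            ((((X.state k).flow (X.time (k + 1) - X.time k)).receive G f j v).flag i).toNat +
            (((X.state k).flow (X.time (k + 1) - X.time k)).receive G f j v).count i := by
          intro i hi
          simp only [OscState.receive, OscState.flow]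
          split_ifs <;> omega
        have hlt := Finset.sum_lt_sum hle ⟨l, hl, by
          simp only [OscState.receive, OscState.flow, if_pos hadj]; omega⟩
        omega
  set B := ∑ i ∈ N, (1 + inDegree G i)
  have h1 := (key (B + 1)).2
  have h2 : ∑ i ∈ N, (((X.state (B + 1)).flag i).toNat + (X.state (B + 1)).count i) ≤ B :=
    Finset.sum_le_sum fun i hi => Nat.add_le_add (Bool.toNat_le _) (hst (B + 1) i hi)
  omega

/-- A single update suffices: its weights sum to `1` and are all at least `α`. This precedes the
invariant, which needs `α ≤ 1` for its budget. -/
theorem le_one (h : X.IsRun G N f α) (hst : X.IsStealthy G N) (hα : 0 ≤ α) : α ≤ 1 := by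
  obtain ⟨k, i, hi, he⟩ := h.exists_update hst
  have hev := h.isEvent k
  rw [he] at hev
  obtain ⟨-, -, -, hup⟩ := hev
  rcases hup with ⟨h1, -⟩ | ⟨-, ω, hω, -⟩
  · have h2 := hst k i hi
    simp only [OscState.flow] at h1
    omega
  · exact hω.le_one hα

theorem invariant_zero (h : X.IsRun G N f α)
    (hphase : ∀ i ∈ N, 0 ≤ (X.state 0).phase i ∧ (X.state 0).phase i < 1 / 2)
    (hfreq : ∀ i ∈ N, 1 ≤ (X.state 0).freq i) :
    OscState.Invariant G N f α X.roundFreq X.roundTime (width N (X.state 0).phase)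
      (X.updates 0) (X.state 0) (X.time 0) := by
  have hU : ∀ i, X.updates 0 i = 0 := fun _ => rfl
  have hw : ∀ i, X.roundFreq 0 i = (X.state 0).freq i := fun i => by
    rw [roundFreq, firstIndex_zero]
  have hτ : ∀ i, X.roundTime 0 i =
      X.time 0 + (1 - (X.state 0).phase i) / (X.state 0).freq i := fun i => by
    rw [roundTime, firstIndex_zero]
  have hfires : ∀ i ∈ N, OscState.fires (X.updates 0) (X.state 0) i = 0 := fun i hi => by
    simp [OscState.fires, h.flag_zero i hi, hU]
  have hlift : ∀ i ∈ N, OscState.lift (X.updates 0) (X.state 0) i = (X.state 0).phase i :=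
    fun i hi => by simp [OscState.lift, hfires i hi]
  refine ⟨⟨⟨fun i hi => ?_, fun i hi q hq => ?_, fun i hi => ?_, fun i hi => (hphase i hi).1,
    fun i hi => ?_, fun i hi hf => ?_, fun i hi j hj => ?_, fun i hi j hj => ?_,
    fun i hi j hj hij => ?_⟩, fun i hi => ?_⟩, fun i hi q hq => ?_, ?_⟩
  · rw [hU, hw]
  · rw [hU, Nat.le_zero] at hq
    rw [hq, hw]; exact hfreq i hi
  · rw [hU, hτ, h.flag_zero i hi]
    have := hfreq i hi
    simp only [Bool.toNat_false]
    field_simp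
    push_cast; ring
  · linarith [(hphase i hi).2]
  · rw [h.flag_zero i hi] at hf
    exact absurd hf (by simp)
  · rw [hU]; exact Nat.zero_le _
  · rw [hfires j hj]; exact Nat.zero_le _
  · rw [hfires j hj, hU] at hij
    omega
  · have hempty : OscState.heard G N (X.updates 0) (X.state 0) i = ∅ := by
      ext l
      rw [OscState.mem_heard]
      simp only [Finset.notMem_empty, iff_false, not_and, OscState.mem_normalNbrs]
      intro hl
      rw [hfires l hl.1, hU]; omega
    rw [hempty]
    have hc := h.count_zero i hi
    refine ⟨⟨0, by simp [h.vals_zero i hi], by simp [hc]⟩, ?_, ?_, fun _ _ => by omega,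
      fun _ _ => by omega, fun _ => ⟨h.zUp_zero i hi, h.zLow_zero i hi⟩⟩
    · rw [h.zUp_zero i hi]; norm_num
    · rw [h.zLow_zero i hi]; norm_num
  · rw [hU] at hq; omega
  · obtain ⟨i, hi⟩ := h.nonempty
    refine ⟨⨆ i : N, (X.state 0).phase i, ⨅ i : N, (X.state 0).phase i, 0,
      ⟨fun j hj => ?_, fun j hj l hl hjl => ?_⟩, fun j hj => Nat.zero_le _, ⟨i, hi, hU i⟩, ?_⟩
    · rw [hlift j hj]; exact ⟨hull_inf_le hj, le_hull_sup hj⟩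
    · rw [hfires l hl, hU] at hjl; omega
    -- Initially `p = 0` and `B ≥ 0`, so at most `3 / 2` widths are to be paid: the term `width N (w
    -- 0) / 2` and the first summand.
    · rw [Finset.sum_range_one]
      have h1 : 0 ≤ ⨅ i : N, (X.state 0).phase i :=
        le_hull_inf ⟨i, hi⟩ fun j hj => (hphase j hj).1
      have h2 := mul_nonneg (width_nonneg ⟨i, hi⟩ : 0 ≤ width N (X.roundFreq 0)) h1
      have h3 : width N (X.state 0).phase =
        (⨆ i : N, (X.state 0).phase i) - ⨅ i : N, (X.state 0).phase i := rfl
      rw [h3, Nat.cast_zero]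
      linarith

theorem flow_time {k : ℕ} : X.time k + (X.time (k + 1) - X.time k) = X.time (k + 1) := by ring

/-- `roundFreq` and `roundTime` are read off the whole execution, so they stay fixed in the
induction, and an update satisfies the required equations by definition. The half-turn bound used
for an event comes from the invariant just before it. -/
theorem invariant [Fintype V] (h : X.IsRun G N f α) (hst : X.IsStealthy G N)
    (hadm : OscState.Admissible G N f α X.roundFreq (width N (X.state 0).phase))
    (hphase : ∀ i ∈ N, 0 ≤ (X.state 0).phase i ∧ (X.state 0).phase i < 1 / 2)
    (hfreq : ∀ i ∈ N, 1 ≤ (X.state 0).freq i) (k : ℕ) :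
    OscState.Invariant G N f α X.roundFreq X.roundTime (width N (X.state 0).phase)
      (X.updates k) (X.state k) (X.time k) := by
  classical
  induction k with
  | zero => exact h.invariant_zero hphase hfreq
  | succ k ih =>
    have hf := ih.flow hadm.nonempty (h.canFlow k)
    rw [flow_time] at hf
    have hev := h.isEvent k
    have hcount := hst (k + 1)
    cases he : X.event k with
    | update i =>
      rw [he] at hev
      obtain ⟨hi, hph, hfl, hup⟩ := hev
      rw [updates_succ_of_update he]
      have hidx := firstIndex_of_update he
      refine hf.update hadm hi hfl hph (hst k i hi) hup ?_ ?_
      · rw [roundFreq, hidx]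
      · rw [roundTime, hidx]
    | fire j =>
      rw [he] at hev
      obtain ⟨hj, hph, hs⟩ := hev
      have hU : X.updates (k + 1) = X.updates k := by
        funext i; exact updates_succ_of_ne (by simp [he])
      rw [hU, hs]
      rw [hs] at hcount
      exact hf.fire hadm hj hph hcount
    | attack j v =>
      rw [he] at hev
      obtain ⟨hj, -, hs⟩ := hev
      have hU : X.updates (k + 1) = X.updates k := by
        funext i; exact updates_succ_of_ne (by simp [he])
      rw [hU, hs]
      rw [hs] at hcount
      exact hf.attack hadm v hcount

end IsRun

end Execution

/-! ### Counting events: boundedly many between two updates of an oscillator. -/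

namespace OscState

variable {V : Type*} {G : Digraph V} {N : Finset V} {f : ℕ} {α : ℝ}
  {w τ : ℕ → V → ℝ} {U : V → ℕ} {S S' : OscState V} {t : ℝ} {i j : V}

/-- A quantity that counts the events which concern `l`: its firings, its updates and the pulses
of misbehaving oscillators that it receives, where every completed round is charged with the
largest possible number of the latter. -/
noncomputable def load (G : Digraph V) (N : Finset V) (U : V → ℕ) (S : OscState V) (l : V) : ℤ :=
  fires U S l + U l + numFaulty G N l * U l + (S.count l - (heard G N U S l).card)

theorem Coherent.card_heard_le (h : Coherent G N f w τ U S t) (hi : i ∈ N) :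
    (heard G N U S i).card ≤ S.count i := by
  obtain ⟨Ms, -, h2⟩ := (h.pulses i hi).vals
  omega

/-- The count of false pulses does not drop, since a heard set can grow only together with its
counter; `fires` grows at `j`. -/
theorem load_fire (hT : Timing N w τ U S t) (hc : Close N U S) (hj : j ∈ N)
    (hphase : S.phase j = 1) :
    (∀ l, load G N U S l ≤ load G N U (S.fire G f j) l) ∧
      load G N U S j < load G N U (S.fire G f j) j := by
  classical
  obtain ⟨hflag, -⟩ := hT.round_eq_of_fire hc hj hphase
  obtain ⟨hf1, hf2⟩ := fires_raise (U := U) hflag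
  have hf : ∀ l, fires U (S.fire G f j) l = fires U (S.raise j) l := fun _ => rfl
  have hmis : ∀ l, (S.count l : ℤ) - (heard G N U S l).card ≤
      (S.fire G f j).count l - (heard G N U (S.fire G f j) l).card := by
    intro l
    by_cases hadj : G.Adj l j
    · have h1 : (S.fire G f j).count l = S.count l + 1 := by
        simp [OscState.fire, receive, hadj]
      have h2 : heard G N U (S.fire G f j) l ⊆ insert j (heard G N U S l) := by
        intro x hx
        rw [mem_heard, hf] at hx
        by_cases hxj : x = j
        · subst hxj; exact Finset.mem_insert_self _ _
        · rw [hf2 x hxj] at hx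
          exact Finset.mem_insert_of_mem (mem_heard.2 hx)
      have h3 := (Finset.card_le_card h2).trans (Finset.card_insert_le _ _)
      omega
    · have h1 : (S.fire G f j).count l = S.count l := by
        simp [OscState.fire, receive, hadj]
      have h2 : heard G N U (S.fire G f j) l ⊆ heard G N U S l := by
        intro x hx
        rw [mem_heard, hf] at hx
        by_cases hxj : x = j
        · subst hxj; exact absurd (mem_normalNbrs.1 hx.1).2 hadj
        · rw [hf2 x hxj] at hx
          exact mem_heard.2 hx
      have h3 := Finset.card_le_card h2
      omega
  have hmono : ∀ l, fires U S l ≤ fires U (S.raise j) l := by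
    intro l
    by_cases hlj : l = j
    · subst hlj; omega
    · exact (hf2 l hlj).ge
  refine ⟨fun l => ?_, ?_⟩
  · have h1 := hmis l
    have h2 := hmono l
    rw [← hf] at h2
    simp only [load]
    omega
  · have h1 := hmis j
    rw [← hf] at hf1
    simp only [load]
    omega

theorem load_receive (u : V → ℝ) :
    (∀ l, load G N U S l ≤ load G N U (S.receive G f j u) l) ∧
      (G.Adj i j → load G N U S i < load G N U (S.receive G f j u) i) := by
  have hf : ∀ l, fires U (S.receive G f j u) l = fires U S l := fun _ => rfl
  have hh : ∀ l, heard G N U (S.receive G f j u) l = heard G N U S l := fun _ => rfl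
  refine ⟨fun l => ?_, fun hadj => ?_⟩
  · have h1 : S.count l ≤ (S.receive G f j u).count l := by
      simp only [receive]; split_ifs <;> omega
    simp only [load, hf, hh]
    omega
  · have h1 : (S.receive G f j u).count i = S.count i + 1 := by simp [receive, hadj]
    simp only [load, hf, hh]
    omega

-- The reset wipes out the false pulses of the round. Stealthiness bounds them by `numFaulty`,
-- because all normal in-neighbours were heard, and the charge for the completed round covers them.
-- The increase of `U i` makes the inequality strict.
open Classical in
theorem load_update [Fintype V] (h : Coherent G N f w τ U S t) (hc : Close N U S) (hi : i ∈ N)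
    (hflag : S.flag i = true) (hphase : S.phase i = 1 / 2) (hcount : S.count i ≤ inDegree G i)
    {p ω : ℝ} (h' : Coherent G N f w τ (Function.update U i (U i + 1)) (reset S i p ω) t) :
    (∀ l, load G N U S l ≤ load G N (Function.update U i (U i + 1)) (reset S i p ω) l) ∧
      load G N U S i < load G N (Function.update U i (U i + 1)) (reset S i p ω) i := by
  have hfires : ∀ j, fires (Function.update U i (U i + 1)) (reset S i p ω) j = fires U S j := by
    intro j
    by_cases hj : j = i
    · subst hj; simp [fires, reset, hflag]
    · simp [fires, reset, hj]
  have hlt : load G N U S i < load G N (Function.update U i (U i + 1)) (reset S i p ω) i := by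
    have h1 := h'.card_heard_le hi
    have h2 : (reset S i p ω).count i = 0 := by simp [reset]
    have h3 : (S.count i : ℤ) - (heard G N U S i).card ≤ numFaulty G N i := by
      rw [h.1.heard_eq_of_update hc hi hflag hphase]
      rw [inDegree_eq (N := N)] at hcount
      omega
    simp only [load, hfires, Function.update_self]
    push_cast
    rw [mul_add]
    omega
  refine ⟨fun l => ?_, hlt⟩
  by_cases hl : l = i
  · subst hl; exact hlt.le
  · have h1 : (reset S i p ω).count l = S.count l := by simp [reset, hl]
    have h2 : heard G N (Function.update U i (U i + 1)) (reset S i p ω) l = heard G N U S l := by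
      ext x
      rw [mem_heard, mem_heard, hfires, Function.update_of_ne hl]
    simp only [load, hfires, h1, h2, Function.update_of_ne hl]
    exact le_rfl

end OscState

namespace Execution

variable {V : Type*} {G : Digraph V} {N : Finset V} {f : ℕ} {α D : ℝ}
  {X : Execution V}

/-- A stealthy run with all of its invariants. -/
structure IsRegular (G : Digraph V) (N : Finset V) (f : ℕ) (α D : ℝ) (X : Execution V) : Prop where
  run : X.IsRun G N f α
  stealthy : X.IsStealthy G N
  adm : OscState.Admissible G N f α X.roundFreq D
  inv : ∀ k, OscState.Invariant G N f α X.roundFreq X.roundTime D (X.updates k) (X.state k)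
    (X.time k)

namespace IsRegular

/-- The state right before the event `k` satisfies the invariant. -/
theorem inv_flow (h : X.IsRegular G N f α D) (k : ℕ) :
    OscState.Invariant G N f α X.roundFreq X.roundTime D (X.updates k)
      ((X.state k).flow (X.time (k + 1) - X.time k)) (X.time (k + 1)) := by
  have := (h.inv k).flow h.adm.nonempty (h.run.canFlow k)
  rwa [IsRun.flow_time] at this

theorem sum_load_lt [Fintype V] (h : X.IsRegular G N f α D) (k : ℕ) :
    ∑ l ∈ N, OscState.load G N (X.updates k) (X.state k) l <
      ∑ l ∈ N, OscState.load G N (X.updates (k + 1)) (X.state (k + 1)) l := by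
  classical
  have hf := h.inv_flow k
  have hc := hf.close h.adm
  have hev := h.run.isEvent k
  suffices hs : ∃ i ∈ N,
      (∀ l, OscState.load G N (X.updates k) (X.state k) l ≤
        OscState.load G N (X.updates (k + 1)) (X.state (k + 1)) l) ∧
      OscState.load G N (X.updates k) (X.state k) i <
        OscState.load G N (X.updates (k + 1)) (X.state (k + 1)) i by
    obtain ⟨i, hi, h1, h2⟩ := hs
    exact Finset.sum_lt_sum (fun l _ => h1 l) ⟨i, hi, h2⟩
  cases he : X.event k with
  | update i =>
    rw [he] at hev
    obtain ⟨hi, hph, hfl, hup⟩ := hev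
    have hcount := h.stealthy k i hi
    obtain ⟨-, -, -, -, h3⟩ := hf.coherent.update_steps hc h.adm.isLocal h.adm.robust
      h.adm.pos.le hi hfl hph hcount hup
    have h' := (h.inv (k + 1)).coherent
    rw [updates_succ_of_update he] at h' ⊢
    rw [h3] at h' ⊢
    exact ⟨i, hi, OscState.load_update hf.coherent hc hi hfl hph hcount h'⟩
  | fire j =>
    rw [he] at hev
    obtain ⟨hj, hph, hs⟩ := hev
    have hU : X.updates (k + 1) = X.updates k := by
      funext i; exact updates_succ_of_ne (by simp [he])
    rw [hU, hs]
    exact ⟨j, hj, OscState.load_fire (S := (X.state k).flow (X.time (k + 1) - X.time k))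
      hf.coherent.timing hc hj hph⟩
  | attack j v =>
    rw [he] at hev
    obtain ⟨hj, ⟨i, hi, hadj⟩, hs⟩ := hev
    have hU : X.updates (k + 1) = X.updates k := by
      funext i; exact updates_succ_of_ne (by simp [he])
    rw [hU, hs]
    obtain ⟨h1, h2⟩ := OscState.load_receive (G := G) (N := N) (f := f) (i := i) (j := j)
      (U := X.updates k) (S := (X.state k).flow (X.time (k + 1) - X.time k)) v
    exact ⟨i, hi, h1, h2 hadj⟩

theorem add_sum_load_le [Fintype V] (h : X.IsRegular G N f α D) (k m : ℕ) :
    ∑ l ∈ N, OscState.load G N (X.updates k) (X.state k) l + m ≤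
      ∑ l ∈ N, OscState.load G N (X.updates (k + m)) (X.state (k + m)) l := by
  induction m with
  | zero => simp
  | succ m ih =>
    have := h.sum_load_lt (k + m)
    rw [← add_assoc]
    push_cast
    omega

/-- Only boundedly many events happen between two updates of a normal oscillator. -/
theorem updatesWithin [Fintype V] (h : X.IsRegular G N f α D) :
    X.UpdatesWithin N (3 * Fintype.card V ^ 2) := by
  classical
  intro k i hi
  by_contra! hcon
  set m := 3 * Fintype.card V ^ 2 with hm
  have hconst : ∀ l ≤ m, X.updates (k + l) i = X.updates k i := by
    intro l
    induction l with
    | zero => intro _; rfl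
    | succ l ih =>
      intro hl
      rw [← add_assoc, updates_succ_of_ne (hcon l hl), ih (by omega)]
  set u := X.updates k i with hu
  have hu' := hconst m le_rfl
  have hsum := h.add_sum_load_le k m
  -- While `U i` is constant, `fires l` rises by at most `1`, `U l` by at most `2`, and the number
  -- of false pulses in the current round by at most the in-degree. For `l = i` the two updates drop
  -- out, and this saving keeps the total below `3 * n ^ 2` even for `n = 1`.
  have hbound : ∀ l ∈ N, OscState.load G N (X.updates (k + m)) (X.state (k + m)) l -
      OscState.load G N (X.updates k) (X.state k) l ≤
        3 + 2 * numFaulty G N l + Fintype.card V - if l = i then 2 else 0 := by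
    intro l hl
    have hT := (h.inv k).coherent
    have hT' := (h.inv (k + m)).coherent
    have h1 := hT.timing.round_le i hi l hl
    have h2 := hT.timing.le_round l hl l hl
    have h3 := hT'.timing.le_round i hi l hl
    have h4 := hT'.timing.round_le l hl l hl
    have h5 := hT.card_heard_le hl
    have h6 := h.stealthy (k + m) l hl
    have h7 : inDegree G l ≤ Fintype.card V := inDegree_le_card l
    have h8 : (numFaulty G N l : ℤ) * X.updates (k + m) l ≤
        numFaulty G N l * (X.updates k l + 2) :=
      mul_le_mul_of_nonneg_left (by omega) (Nat.cast_nonneg _)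
    rw [mul_add] at h8
    simp only [OscState.load]
    by_cases hli : l = i
    · subst hli
      rw [if_pos rfl, hu', ← hu]
      have h9 : (0 : ℤ) ≤ numFaulty G N l := Nat.cast_nonneg _
      omega
    · rw [if_neg hli]
      omega
  have htotal := Finset.sum_le_sum hbound
  rw [Finset.sum_sub_distrib, Finset.sum_sub_distrib, Finset.sum_ite_eq' N i, if_pos hi] at htotal
  have hfault : ∑ l ∈ N, ((3 : ℤ) + 2 * numFaulty G N l + Fintype.card V) ≤
      ∑ _l ∈ N, ((3 : ℤ) + 2 * (Fintype.card V - N.card) + Fintype.card V) := by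
    refine Finset.sum_le_sum fun l _ => ?_
    have : numFaulty G N l + N.card ≤ Fintype.card V := numFaulty_add_card_le l
    omega
  rw [Finset.sum_const, nsmul_eq_mul] at hfault
  have h1 : (1 : ℤ) ≤ N.card := by exact_mod_cast Finset.card_pos.2 ⟨i, hi⟩
  have h2 : (N.card : ℤ) ≤ Fintype.card V := by exact_mod_cast N.card_le_univ
  have h3 : (m : ℤ) = 3 * (Fintype.card V : ℤ) ^ 2 := by rw [hm]; push_cast; ring
  generalize (N.card : ℤ) = R at *
  generalize (Fintype.card V : ℤ) = n at *
  nlinarith [sq_nonneg (4 * R - 3), mul_nonneg (sub_nonneg.2 h1) (sub_nonneg.2 h2),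
    sq_nonneg (n - R)]

end IsRegular

theorem UpdatesWithin.le_updates {K : ℕ} (hK : X.UpdatesWithin N K) {i : V}
    (hi : i ∈ N) {q k : ℕ} (hq : q * K ≤ k) : q ≤ X.updates k i := by
  classical
  refine le_trans ?_ (X.updates_mono i hq)
  clear hq
  induction q with
  | zero => exact Nat.zero_le _
  | succ q ih =>
    obtain ⟨l, hl, he⟩ := hK (q * K) i hi
    have h1 : X.updates (q * K + l + 1) i = X.updates (q * K + l) i + 1 := by
      simp [updates, he]
    have h2 := X.updates_mono i (show q * K ≤ q * K + l by omega)
    have h3 := X.updates_mono i (show q * K + l + 1 ≤ (q + 1) * K by rw [Nat.succ_mul]; omega)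
    simp only at h2 h3 ih ⊢
    omega

theorem exists_update_of_lt {i : V} {q k : ℕ} (h : q < X.updates k i) :
    ∃ l, X.event l = .update i ∧ X.updates l i = q := by
  classical
  induction k with
  | zero => exact absurd h (Nat.not_lt_zero _)
  | succ k ih =>
    by_cases hlt : q < X.updates k i
    · exact ih hlt
    · by_cases he : X.event k = .update i
      · refine ⟨k, he, ?_⟩
        simp only [updates, if_pos he] at h
        omega
      · rw [updates_succ_of_ne he] at h
        exact absurd h hlt

end Execution

/-! ### From firing times and frequencies of one round to the containing arc. -/

namespace OscState

variable {V : Type*} {G : Digraph V} {N : Finset V} {f : ℕ} {α D : ℝ}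
  {w τ : ℕ → V → ℝ} {U : V → ℕ} {S S' : OscState V} {t : ℝ} {i j : V}

theorem arc_le_of_mem {x : V → ℕ} {a L : ℝ} (hL : 0 ≤ L)
    (h : ∀ i ∈ N, (x i : ℝ) + S.phase i ∈ Set.Icc a (a + L)) : S.arc N ≤ L := by
  refine csInf_le ⟨0, fun _ h => h.1⟩ ⟨hL, a, fun i hi => ⟨x i, ?_⟩⟩
  have h1 := h i hi
  rw [add_comm (x i : ℝ)] at h1
  exact_mod_cast h1

theorem arc_nonneg : 0 ≤ S.arc N :=
  Real.sInf_nonneg fun _ h => h.1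

theorem width_phase_le_arc (hN : N.Nonempty)
    (h : ∀ i ∈ N, 0 ≤ S.phase i ∧ S.phase i < 1 / 2) : width N S.phase ≤ S.arc N := by
  refine le_csInf ⟨1 / 2, by norm_num, 0, fun i hi => ⟨0, ?_, ?_⟩⟩ ?_
  · simpa using (h i hi).1
  · simpa using (h i hi).2.le
  rintro L ⟨hL, a, ha⟩
  have key : ∀ i ∈ N, ∀ j ∈ N, S.phase i ≤ S.phase j + L := by
    intro i hi j hj
    obtain ⟨m, hm⟩ := ha i hi
    obtain ⟨n, hn⟩ := ha j hj
    -- If the arc wraps around between `j` and `i`, it is longer than `1 / 2`, hence longer than any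
    -- phase difference.
    rcases lt_or_ge (m - n) 0 with hmn | hmn
    · have h1 : (m : ℝ) - n ≤ -1 := by exact_mod_cast (by omega : m - n ≤ -1)
      linarith [hm.1, hn.2, (h i hi).2, (h j hj).1]
    · have h1 : (0 : ℝ) ≤ (m : ℝ) - n := by exact_mod_cast hmn
      linarith [hm.2, hn.1]
  rw [width, sub_le_iff_le_add]
  refine hull_sup_le hN fun i hi => ?_
  rw [← sub_le_iff_le_add']
  exact le_hull_inf hN fun j hj => by linarith [key i hi j hj]

/-- The normal phases are close if, in the current round, the firing times are close and the
frequencies are close. -/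
theorem Timing.arc_le (h : Timing N w τ U S t) (hN : N.Nonempty) {q : ℕ}
    (hU : ∀ i ∈ N, U i = q ∨ U i = q + 1) {H : ℝ} (hH : ⨅ i : N, w q i ≤ H)
    (hfreq : ∀ i ∈ N, S.freq i ∈ Set.Icc (⨅ j : N, w q j) (⨆ j : N, w q j))
    (hstep : ∀ i ∈ N, ConsensusStep G N f (1 / 2) (2 * width N (w q)) (τ q) i
      (τ (q + 1) i - 1 / ⨅ j : N, w q j)) :
    S.arc N ≤ 2 * (width N (w q) + H * (width N (τ q) + 2 * width N (w q))) := by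
  set lo := ⨅ j : N, w q j with hlo
  set δ := width N (w q) with hδ
  set σ := width N (τ q) with hσ
  set m := ⨅ j : N, τ q j with hm
  have hδ0 : 0 ≤ δ := width_nonneg hN
  have hσ0 : 0 ≤ σ := width_nonneg hN
  have hlo1 : 1 ≤ lo := le_hull_inf hN fun i hi => h.one_le i hi q (by
    rcases hU i hi with h | h <;> omega)
  have hE0 : lo * (σ + 2 * δ) ≤ H * (σ + 2 * δ) :=
    mul_le_mul_of_nonneg_right hH (by linarith)
  -- All lifted phases are compared with one reference motion, of rate `lo` and firing at time `m`.
  -- The rate mismatch costs `δ` because `|t - τ (U i) i| ≤ 1`. The mismatch of firing times costs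
  -- at most `lo * (σ + 2 * δ)`, where for oscillators already in round `q + 1` the shift `1 / lo`
  -- is exactly one turn.
  have hlift : ∀ i ∈ N, |lift U S i - (q + 1 + lo * (t - m))| ≤ δ + lo * (σ + 2 * δ) := by
    intro i hi
    have h1 := h.one_le_freq hi
    have h2 := hfreq i hi
    have h3 := h.phase_eq i hi
    have h4 : |t - τ (U i) i| ≤ 1 := by
      have h5 := h.phase_nonneg i hi
      have h6 := h.phase_le_one i hi
      have h7 : |S.freq i * (t - τ (U i) i)| ≤ 1 := by
        rw [abs_le]
        cases hf : S.flag i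
        · rw [hf] at h3
          simp only [Bool.toNat_false, Nat.cast_zero] at h3
          constructor <;> linarith
        · rw [hf] at h3
          simp only [Bool.toNat_true, Nat.cast_one] at h3
          constructor <;> linarith
      rw [abs_mul, abs_of_pos (by linarith)] at h7
      exact (le_mul_of_one_le_left (abs_nonneg _) h1).trans h7
    have h5 : |(S.freq i - lo) * (t - τ (U i) i)| ≤ δ := by
      rw [abs_mul, abs_of_nonneg (by linarith [h2.1])]
      have h6 : S.freq i - lo ≤ δ := by rw [hδ, width]; linarith [h2.2]
      calc _ ≤ (S.freq i - lo) * 1 := mul_le_mul_of_nonneg_left h4 (by linarith [h2.1])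
        _ ≤ δ := by linarith
    rw [h.lift_eq hi]
    rcases hU i hi with hUi | hUi
    · have h6 : U i + 1 + S.freq i * (t - τ (U i) i) - (q + 1 + lo * (t - m)) =
          (S.freq i - lo) * (t - τ (U i) i) - lo * (τ q i - m) := by rw [hUi]; ring
      have h7 : 0 ≤ τ q i - m := sub_nonneg.2 (hull_inf_le hi)
      have h8 : τ q i - m ≤ σ := sub_le_sub_right (le_hull_sup hi) _
      rw [h6]
      refine (abs_sub _ _).trans (add_le_add h5 ?_)
      rw [abs_of_nonneg (mul_nonneg (by linarith) h7)]
      exact mul_le_mul_of_nonneg_left (by linarith) (by linarith)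
    · have h9 : lo * (1 / lo) = 1 := mul_one_div_cancel (by linarith)
      have h6 : U i + 1 + S.freq i * (t - τ (U i) i) - (q + 1 + lo * (t - m)) =
          (S.freq i - lo) * (t - τ (U i) i) - lo * (τ (q + 1) i - 1 / lo - m) := by
        rw [hUi]; push_cast; linear_combination -h9
      have h7 := (hstep i hi).ge_of_bound hi fun j hj => hull_inf_le hj
      have h8 := (hstep i hi).le_of_bound hi fun j hj => le_hull_sup hj
      rw [h6]
      refine (abs_sub _ _).trans (add_le_add h5 ?_)
      rw [abs_mul, abs_of_pos (by linarith)]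
      refine mul_le_mul_of_nonneg_left (abs_le.2 ⟨?_, ?_⟩) (by linarith)
      · linarith
      · have : (⨆ j : N, τ q j) = σ + m := by rw [hσ, width]; ring
        linarith
  refine arc_le_of_mem (x := fires U S) (a := q + 1 + lo * (t - m) - (δ + H * (σ + 2 * δ))) ?_ ?_
  · have : 0 ≤ lo * (σ + 2 * δ) := mul_nonneg (by linarith) (by linarith)
    linarith
  · intro i hi
    have h1 := abs_le.1 (hlift i hi)
    simp only [lift] at h1
    exact ⟨by linarith, by linarith⟩

end OscState

/-! ### Exponential synchronization in the number of rounds. -/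

namespace Execution

variable {V : Type*} {G : Digraph V} {N : Finset V} {f : ℕ} {α D : ℝ} {X : Execution V}

namespace IsRegular

theorem exists_lt_updates [Fintype V] (h : X.IsRegular G N f α D) (q : ℕ) :
    ∃ k, ∀ i ∈ N, q < X.updates k i :=
  ⟨_, fun _ hi => h.updatesWithin.le_updates hi (q := q + 1) le_rfl⟩

theorem freq_step [Fintype V] (h : X.IsRegular G N f α D) (q : ℕ) {i : V} (hi : i ∈ N) :
    ConsensusStep G N f α 0 (X.roundFreq q) i (X.roundFreq (q + 1) i) := by
  obtain ⟨k, hk⟩ := h.exists_lt_updates q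
  exact (h.inv k).freq_step i hi q (hk i hi)

theorem one_le_roundFreq [Fintype V] (h : X.IsRegular G N f α D) (q : ℕ) {i : V} (hi : i ∈ N) :
    1 ≤ X.roundFreq q i := by
  obtain ⟨k, hk⟩ := h.exists_lt_updates q
  exact (h.inv k).coherent.timing.one_le i hi q (hk i hi).le

theorem roundFreq_mem_hull [Fintype V] (h : X.IsRegular G N f α D) {p q : ℕ} (hpq : p ≤ q) :
    ∀ i ∈ N, X.roundFreq q i ∈
      Set.Icc (⨅ j : N, X.roundFreq p j) (⨆ j : N, X.roundFreq p j) := by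
  induction q, hpq using Nat.le_induction with
  | base => exact fun i hi => ⟨hull_inf_le hi, le_hull_sup hi⟩
  | succ q hq ih =>
    intro i hi
    have h1 := (h.freq_step q hi).le_of_bound hi fun j hj => (ih j hj).2
    have h2 := (h.freq_step q hi).ge_of_bound hi fun j hj => (ih j hj).1
    exact ⟨by linarith, by linarith⟩

theorem width_roundFreq_anti [Fintype V] (h : X.IsRegular G N f α D) :
    Antitone fun q => width N (X.roundFreq q) :=
  antitone_nat_of_succ_le fun q =>
    OscState.width_succ_le h.adm.nonempty fun _ hi => h.freq_step q hi

theorem width_roundFreq_contraction [Fintype V] (h : X.IsRegular G N f α D) {n : ℕ}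
    (hn : N.card ≤ n + 1) (q : ℕ) :
    width N (X.roundFreq (q + n)) ≤ (1 - α ^ n / 2) * width N (X.roundFreq q) := by
  have := width_contraction h.adm.nonempty h.adm.robust h.adm.pos h.adm.le_one le_rfl
    (v := X.roundFreq) (c := fun _ => 0) (a := q) (n := n)
    (fun r _ _ i hi => by simpa using h.freq_step r hi) hn
  linarith

/-- The firing times make a resilient consensus step in every round, up to a common shift and an
error that is bounded by the differences of the frequencies. -/
theorem time_step [Fintype V] (h : X.IsRegular G N f α D) (q : ℕ) {i : V} (hi : i ∈ N) :
    ConsensusStep G N f (1 / 2) (2 * width N (X.roundFreq q)) (X.roundTime q) i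
      (X.roundTime (q + 1) i - 1 / ⨅ j : N, X.roundFreq q j) := by
  classical
  obtain ⟨k₀, hk₀⟩ := h.exists_lt_updates q
  obtain ⟨k, he, hq⟩ := exists_update_of_lt (hk₀ i hi)
  have hf := h.inv_flow k
  have hev := h.run.isEvent k
  rw [he] at hev
  obtain ⟨-, hph, hfl, hup⟩ := hev
  have hidx := firstIndex_of_update he
  obtain ⟨-, -, hp, ⟨y, hy, hy'⟩, -⟩ := hf.coherent.update_steps (hf.close h.adm) h.adm.isLocal
    h.adm.robust h.adm.pos.le hi hfl hph (h.stealthy k i hi) hup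
  have hT := hf.coherent.timing
  have h1 := hT.phase_eq i hi
  have h2 : (X.state (k + 1)).freq i = X.roundFreq (q + 1) i := by rw [roundFreq, ← hq, hidx]
  have h3 : X.roundTime (q + 1) i = X.time (k + 1) +
      (1 - (X.state (k + 1)).phase i) / X.roundFreq (q + 1) i := by
    rw [← h2, ← hq, roundTime, hidx]
  rw [hfl, hph] at h1
  rw [hT.freq_eq i hi, hq] at h1 hy
  rw [hq] at hy'
  simp only [Bool.toNat_true, Nat.cast_one] at h1
  refine hy'.perturb ?_
  have hω := h.roundFreq_mem_hull (le_refl q) i hi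
  have hω' := h.roundFreq_mem_hull (Nat.le_succ q) i hi
  have hlo : 1 ≤ ⨅ j : N, X.roundFreq q j :=
    le_hull_inf h.adm.nonempty fun j hj => h.one_le_roundFreq q hj
  rw [h3, hy]
  rw [hy] at hp
  rw [width]
  generalize (⨅ j : N, X.roundFreq q j) = lo at *
  generalize (⨆ j : N, X.roundFreq q j) = hi at *
  generalize X.roundFreq q i = ω at *
  generalize X.roundFreq (q + 1) i = ω' at *
  generalize X.roundTime q i = s at *
  have hω1 : 1 ≤ ω := hlo.trans hω.1
  have hω1' : 1 ≤ ω' := hlo.trans hω'.1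
  have ht : X.time (k + 1) = s + 1 / (2 * ω) := by
    field_simp
    linarith
  set r := s - y with hr
  have hr4 : |r| ≤ 1 / 4 := by
    rw [add_sub_cancel_left, abs_mul, abs_of_pos (by linarith)] at hp
    exact (le_mul_of_one_le_left (abs_nonneg _) hω1).trans hp
  -- The half turn before the update is run at frequency `ω`, the one after it at `ω'`, and the
  -- phase correction `ω * r` is undone at `ω'`. Compared with frequency `lo` this costs at most `1
  -- / 2`, `1 / 2` and `1 / 4` of the frequency width, generously rounded up to `2`.
  have hdecomp : X.time (k + 1) + (1 - (1 / 2 + ω * r)) / ω' - 1 / lo - y =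
      -((ω - lo) / (2 * ω * lo)) - (ω' - lo) / (2 * ω' * lo) + r * ((ω' - ω) / ω') := by
    have hy0 : y = s - r := by rw [hr]; ring
    rw [ht, hy0]
    field_simp
    ring
  have hfrac : ∀ x, lo ≤ x → x ≤ hi → 0 ≤ (x - lo) / (2 * x * lo) ∧
      (x - lo) / (2 * x * lo) ≤ (hi - lo) / 2 := by
    intro x hx hx'
    have hx1 : 1 ≤ x := hlo.trans hx
    refine ⟨div_nonneg (by linarith) (by positivity), ?_⟩
    refine div_le_div₀ (by linarith) (by linarith) (by norm_num) ?_
    nlinarith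
  have hthird : |r * ((ω' - ω) / ω')| ≤ 1 / 4 * (hi - lo) := by
    rw [abs_mul, abs_div, abs_of_pos (by linarith : 0 < ω')]
    refine mul_le_mul hr4 ?_ (by positivity) (by norm_num)
    refine (div_le_self (abs_nonneg _) hω1').trans (abs_le.2 ⟨?_, ?_⟩)
    · linarith [hω.2, hω'.1]
    · linarith [hω.1, hω'.2]
  rw [hdecomp]
  have h5 := hfrac ω hω.1 hω.2
  have h6 := hfrac ω' hω'.1 hω'.2
  have h7 := abs_le.1 hthird
  have h8 : lo ≤ hi := hω.1.trans hω.2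
  rw [abs_le]
  constructor <;> linarith [h5.1, h5.2, h6.1, h6.2, h7.1, h7.2]

theorem width_roundTime_contraction [Fintype V] (h : X.IsRegular G N f α D) (q : ℕ) :
    width N (X.roundTime (q + N.card)) ≤ (1 - (1 / 2) ^ N.card / 2) * width N (X.roundTime q) +
      4 * N.card * width N (X.roundFreq q) := by
  have := width_contraction h.adm.nonempty h.adm.robust (β := 1 / 2) (by norm_num) (by norm_num)
    (e := 2 * width N (X.roundFreq q)) (mul_nonneg two_pos.le (width_nonneg h.adm.nonempty))
    (v := X.roundTime) (c := fun r => 1 / ⨅ j : N, X.roundFreq r j) (a := q) (n := N.card)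
    (fun r hr _ i hi => (h.time_step r hi).mono
      (mul_le_mul_of_nonneg_left (h.width_roundFreq_anti hr) two_pos.le)) (by omega)
  linarith

/-- Frequencies and firing times synchronize exponentially in the number of rounds. -/
theorem exists_round_bound [Fintype V] (h : X.IsRegular G N f α D) :
    ∃ C ρ : ℝ, 0 ≤ C ∧ 0 < ρ ∧ ρ < 1 ∧ ∀ q, width N (X.roundFreq q) ≤ C * ρ ^ q ∧
      width N (X.roundTime q) ≤ C * ρ ^ q := by
  have hN := h.adm.nonempty
  have hα := h.adm.pos
  set R := N.card with hR
  have hR1 : 1 ≤ R := hN.card_pos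
  have hpow1 : α ^ R ≤ 1 := pow_le_one₀ hα.le h.adm.le_one
  have hpow2 : ((1 : ℝ) / 2) ^ R ≤ 1 := pow_le_one₀ (by norm_num) (by norm_num)
  set γ := min (α ^ R / 2) ((1 / 2) ^ R / 2) with hγ
  have hγ0 : 0 < γ := lt_min (by positivity) (by positivity)
  have hγ1 : γ ≤ 1 / 2 := (min_le_left _ _).trans (by linarith)
  -- The frequency width drives the firing times but not conversely, so a large multiple of it is
  -- added as a Lyapunov term. The choice `E * γ = 8 * R` absorbs the coupling `4 * R` into half of
  -- its decay.
  set E := 8 * (R : ℝ) / γ with hE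
  have hR1' : (1 : ℝ) ≤ R := by exact_mod_cast hR1
  have hE1 : 1 ≤ E := by rw [hE, le_div_iff₀ hγ0]; linarith
  have hE2 : E * γ = 8 * R := by rw [hE]; field_simp
  have hδ0 : ∀ q, 0 ≤ width N (X.roundFreq q) := fun q => width_nonneg hN
  have hσ0 : ∀ q, 0 ≤ width N (X.roundTime q) := fun q => width_nonneg hN
  obtain ⟨C, ρ, hC, hρ0, hρ1, hb⟩ := exists_geometric_bound
    (a := fun q => width N (X.roundTime q) + E * width N (X.roundFreq q)) (κ := 1 - γ / 2)
    hR1 (by linarith) (by linarith)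
    (fun q => add_nonneg (hσ0 q) (mul_nonneg (by linarith) (hδ0 q))) (fun q => by
      have h1 := h.width_roundTime_contraction q
      have h2 := h.width_roundFreq_contraction (n := R) (by omega) q
      have h3 : (1 - (1 / 2) ^ R / 2) * width N (X.roundTime q) ≤
          (1 - γ / 2) * width N (X.roundTime q) :=
        mul_le_mul_of_nonneg_right (by linarith [min_le_right (α ^ R / 2) ((1 / 2) ^ R / 2)])
          (hσ0 q)
      have h4 : (1 - α ^ R / 2) * width N (X.roundFreq q) ≤
          (1 - γ) * width N (X.roundFreq q) :=
        mul_le_mul_of_nonneg_right (by linarith [min_le_left (α ^ R / 2) ((1 / 2) ^ R / 2)])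
          (hδ0 q)
      have h5 := mul_le_mul_of_nonneg_left (h2.trans h4) (by linarith : (0 : ℝ) ≤ E)
      have h6 : E * ((1 - γ) * width N (X.roundFreq q)) + 4 * R * width N (X.roundFreq q) =
          (1 - γ / 2) * (E * width N (X.roundFreq q)) := by
        linear_combination (-(1 / 2) * width N (X.roundFreq q)) * hE2
      rw [← hR] at h1
      linarith)
  refine ⟨C, ρ, hC, hρ0, hρ1, fun q => ?_⟩
  have h1 := hb q
  have h2 := mul_le_mul_of_nonneg_right hE1 (hδ0 q)
  have h3 := hδ0 q
  have h4 := hσ0 q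
  constructor <;> nlinarith

theorem exists_slowest (h : X.IsRegular G N f α D) (k : ℕ) :
    ∃ i ∈ N, ∀ j ∈ N, X.updates k j = X.updates k i ∨ X.updates k j = X.updates k i + 1 := by
  obtain ⟨A, B, p, -, hp, ⟨i, hi, hip⟩, -⟩ := (h.inv k).envelope
  refine ⟨i, hi, fun j hj => ?_⟩
  have h1 := (h.inv k).coherent.timing.le_round i hi j hj
  have h2 := hp j hj
  have h3 : X.updates k j ≤ OscState.fires (X.updates k) (X.state k) j := Nat.le_add_right _ _
  omega

theorem freq_mem_hull [Fintype V] (h : X.IsRegular G N f α D) {k p : ℕ} {i : V} (hi : i ∈ N)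
    (hp : p ≤ X.updates k i) : (X.state k).freq i ∈
      Set.Icc (⨅ j : N, X.roundFreq p j) (⨆ j : N, X.roundFreq p j) := by
  rw [(h.inv k).coherent.timing.freq_eq i hi]
  exact h.roundFreq_mem_hull hp i hi

/-- Lifted phases grow at rates between the extreme frequencies, apart from the corrections. -/
theorem lift_mem [Fintype V] (h : X.IsRegular G N f α D)
    (hphase : ∀ i ∈ N, 0 ≤ (X.state 0).phase i ∧ (X.state 0).phase i < 1 / 2) (k : ℕ) {i : V}
    (hi : i ∈ N) : OscState.lift (X.updates k) (X.state k) i ∈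
      Set.Icc (X.time k - X.updates k i / 4)
        (1 / 2 + (⨆ j : N, X.roundFreq 0 j) * X.time k + X.updates k i / 4) := by
  classical
  induction k with
  | zero =>
    have h1 : OscState.lift (X.updates 0) (X.state 0) i = (X.state 0).phase i := by
      simp [OscState.lift, OscState.fires, h.run.flag_zero i hi, updates]
    have h2 : X.updates 0 i = 0 := rfl
    rw [h1, h2, h.run.time_zero]
    have := hphase i hi
    exact ⟨by simpa using this.1, by simpa using this.2.le⟩
  | succ k ih =>
    have hf := h.inv_flow k
    have hc := hf.close h.adm
    have hev := h.run.isEvent k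
    have hr := (h.run.canFlow k).1
    have hω := h.freq_mem_hull hi (Nat.zero_le (X.updates k i))
    have hω1 := (h.inv k).coherent.timing.one_le_freq hi
    have h1 : OscState.lift (X.updates k)
        ((X.state k).flow (X.time (k + 1) - X.time k)) i =
        OscState.lift (X.updates k) (X.state k) i +
          (X.time (k + 1) - X.time k) * (X.state k).freq i := by
      simp only [OscState.lift, OscState.fires, OscState.flow]; ring
    have h2 := le_mul_of_one_le_right hr hω1
    have h3 := mul_le_mul_of_nonneg_left hω.2 hr
    have hflow : OscState.lift (X.updates k)
        ((X.state k).flow (X.time (k + 1) - X.time k)) i ∈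
        Set.Icc (X.time (k + 1) - X.updates k i / 4)
          (1 / 2 + (⨆ j : N, X.roundFreq 0 j) * X.time (k + 1) + X.updates k i / 4) := by
      rw [h1]
      exact ⟨by linarith [ih.1], by linarith [ih.2]⟩
    cases he : X.event k with
    | update j =>
      rw [he] at hev
      obtain ⟨hj, hph, hfl, hup⟩ := hev
      obtain ⟨-, -, hp, -, hS⟩ := hf.coherent.update_steps hc h.adm.isLocal h.adm.robust
        h.adm.pos.le hj hfl hph (h.stealthy k j hj) hup
      by_cases hij : i = j
      · subst hij
        have h4 : (X.state (k + 1)).flag i = false := by rw [hS]; simp [OscState.reset]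
        have h5 : OscState.lift (X.updates (k + 1)) (X.state (k + 1)) i =
            OscState.lift (X.updates k) ((X.state k).flow (X.time (k + 1) - X.time k)) i +
              ((X.state (k + 1)).phase i - 1 / 2) := by
          rw [updates_succ_of_update he]
          simp only [OscState.lift, OscState.fires, h4, hfl, hph, Function.update_self]
          push_cast
          simp
        have h6 := abs_le.1 hp
        rw [h5, updates_succ_of_update he, Function.update_self]
        push_cast
        exact ⟨by linarith [hflow.1], by linarith [hflow.2]⟩
      · have h4 : (X.state (k + 1)).flag i = (X.state k).flag i := by
          rw [hS]; simp [OscState.reset, hij, OscState.flow]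
        have h6 : (X.state (k + 1)).phase i =
            ((X.state k).flow (X.time (k + 1) - X.time k)).phase i := by
          rw [hS]; simp [OscState.reset, hij]
        have h5 : OscState.lift (X.updates (k + 1)) (X.state (k + 1)) i =
            OscState.lift (X.updates k) ((X.state k).flow (X.time (k + 1) - X.time k)) i := by
          rw [updates_succ_of_update he]
          simp only [OscState.lift, OscState.fires, h4, h6, Function.update_of_ne hij]
          rfl
        rw [h5, updates_succ_of_update he, Function.update_of_ne hij]
        exact hflow
    | fire j =>
      rw [he] at hev
      obtain ⟨hj, hph, hs⟩ := hev
      have hU : X.updates (k + 1) = X.updates k := by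
        funext i; exact updates_succ_of_ne (by simp [he])
      obtain ⟨hflag, -⟩ := hf.coherent.timing.round_eq_of_fire hc hj hph
      rw [hU, hs]
      have h4 := OscState.lift_raise (U := X.updates k) hflag hph i
      rw [← h4] at hflow
      exact hflow
    | attack j v =>
      rw [he] at hev
      obtain ⟨hj, -, hs⟩ := hev
      have hU : X.updates (k + 1) = X.updates k := by
        funext i; exact updates_succ_of_ne (by simp [he])
      rw [hU, hs]
      exact hflow

end IsRegular

end Execution

/-! ### Decay rates in events and in time, and the theorem. -/

namespace Execution

variable {V : Type*} {G : Digraph V} {N : Finset V} {f : ℕ} {α D : ℝ} {X : Execution V}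

theorem roundFreq_zero (X : Execution V) : X.roundFreq 0 = (X.state 0).freq := by
  funext i; rw [roundFreq, firstIndex_zero]

theorem spread_zero {K : ℕ} (hK : 1 ≤ K) :
    X.spread N K 0 = width N (X.roundFreq 0) := by
  have : Nonempty (Fin K) := ⟨⟨0, hK⟩⟩
  simp only [spread, windowMax, windowMin, Nat.zero_sub, ciSup_const, ciInf_const, roundFreq_zero]
  rfl

theorem spread_nonneg {K : ℕ} (hK : 1 ≤ K) (hN : N.Nonempty) (k : ℕ) : 0 ≤ X.spread N K k := by
  obtain ⟨i, hi⟩ := hN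
  have h1 : (X.state (k - (⟨0, hK⟩ : Fin K))).maxFreq N ≤ X.windowMax N K k :=
    le_ciSup (f := fun l : Fin K => (X.state (k - l)).maxFreq N) (Set.finite_range _).bddAbove _
  have h2 : X.windowMin N K k ≤ (X.state (k - (⟨0, hK⟩ : Fin K))).minFreq N :=
    ciInf_le (f := fun l : Fin K => (X.state (k - l)).minFreq N) (Set.finite_range _).bddBelow _
  have h3 := (hull_inf_le (v := (X.state (k - (⟨0, hK⟩ : Fin K))).freq) hi).trans (le_hull_sup hi)
  exact sub_nonneg.2 (h2.trans (h3.trans h1))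

namespace IsRegular

theorem spread_le_width [Fintype V] (h : X.IsRegular G N f α D) {K : ℕ} (hK : 1 ≤ K) {k p : ℕ}
    (hp : ∀ i ∈ N, ∀ l < K, p ≤ X.updates (k - l) i) :
    X.spread N K k ≤ width N (X.roundFreq p) := by
  have : Nonempty (Fin K) := ⟨⟨0, hK⟩⟩
  refine sub_le_sub (ciSup_le fun l => ?_) (le_ciInf fun l => ?_)
  · exact hull_sup_le h.adm.nonempty fun i hi => (h.freq_mem_hull hi (hp i hi l l.2)).2
  · exact le_hull_inf h.adm.nonempty fun i hi => (h.freq_mem_hull hi (hp i hi l l.2)).1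

theorem width_roundFreq_le_pow [Fintype V] (h : X.IsRegular G N f α D) {n : ℕ}
    (hn : N.card ≤ n + 1) (q : ℕ) :
    width N (X.roundFreq (q * n)) ≤ (1 - α ^ n / 2) ^ q * width N (X.roundFreq 0) := by
  have h0 : 0 ≤ 1 - α ^ n / 2 := by
    have := pow_le_one₀ h.adm.pos.le h.adm.le_one (n := n)
    linarith
  induction q with
  | zero => simp
  | succ q ih =>
    rw [Nat.succ_mul, pow_succ']
    have h1 := h.width_roundFreq_contraction hn (q * n)
    have h2 := mul_le_mul_of_nonneg_left ih h0
    linarith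

theorem spread_le [Fintype V] (h : X.IsRegular G N f α D) {K : ℕ} (hK : 1 ≤ K)
    (hup : X.UpdatesWithin N K) (k : ℕ) :
    X.spread N K k ≤
      (1 - α ^ (K * N.card) / 2) ^ (k / (K * N.card)) * X.spread N K 0 := by
  have hα := h.adm.pos
  have hα1 := h.adm.le_one
  have hR : 1 ≤ N.card := h.adm.nonempty.card_pos
  rw [spread_zero hK]
  set q := k / (K * N.card) with hq
  have hqk : q * (K * N.card) ≤ k := Nat.div_mul_le_self _ _
  -- `R - 1` rounds suffice for one contraction. Out of each block of `K * R` events this leaves `K`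
  -- events to spare, which cover the look-back of the window.
  have hp : ∀ i ∈ N, ∀ l < K, q * (N.card - 1) ≤ X.updates (k - l) i := by
    intro i hi l hl
    rcases Nat.eq_zero_or_pos q with h0 | h0
    · rw [h0, zero_mul]; exact Nat.zero_le _
    · refine hup.le_updates hi ?_
      obtain ⟨r, hr⟩ := Nat.exists_eq_add_of_le' hR
      rw [hr, Nat.add_sub_cancel]
      rw [hr] at hqk
      have h1 : q * (K * (r + 1)) = q * r * K + q * K := by ring
      have h2 : K ≤ q * K := Nat.le_mul_of_pos_left _ h0
      omega
  refine (h.spread_le_width hK hp).trans ((h.width_roundFreq_le_pow (by omega) q).trans ?_)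
  refine mul_le_mul_of_nonneg_right (pow_le_pow_left₀ ?_ ?_ _) (width_nonneg h.adm.nonempty)
  · have := pow_le_one₀ hα.le hα1 (n := N.card - 1)
    linarith
  · have h1 : N.card ≤ K * N.card := Nat.le_mul_of_pos_left _ hK
    have := pow_le_pow_of_le_one hα.le hα1 (show N.card - 1 ≤ K * N.card by omega)
    linarith

theorem tendsto_spread [Fintype V] (h : X.IsRegular G N f α D) {K : ℕ} (hK : 1 ≤ K)
    (hup : X.UpdatesWithin N K) : Tendsto (X.spread N K) atTop (𝓝 0) := by
  have hα := h.adm.pos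
  have hR : 1 ≤ N.card := h.adm.nonempty.card_pos
  have h0 : 0 < α ^ (K * N.card) := by positivity
  have h1 : α ^ (K * N.card) ≤ 1 := pow_le_one₀ hα.le h.adm.le_one
  have hpos : K * N.card ≠ 0 := Nat.mul_ne_zero (by omega) (by omega)
  have h2 : Tendsto (fun k => (1 - α ^ (K * N.card) / 2) ^ (k / (K * N.card)) * X.spread N K 0)
      atTop (𝓝 (0 * X.spread N K 0)) :=
    ((tendsto_pow_atTop_nhds_zero_of_lt_one (by linarith) (by linarith)).comp
      (Nat.tendsto_div_const_atTop hpos)).mul_const _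
  rw [zero_mul] at h2
  exact squeeze_zero (spread_nonneg hK h.adm.nonempty) (h.spread_le hK hup) h2

/-- A lifted phase is at least the number of updates, of which the corrections supply at most a
quarter; the rest must come from elapsed time at rate at most `H`. So infinitely many updates need
infinite time. -/
theorem tendsto_time [Fintype V] (h : X.IsRegular G N f α D)
    (hphase : ∀ i ∈ N, 0 ≤ (X.state 0).phase i ∧ (X.state 0).phase i < 1 / 2) :
    Tendsto X.time atTop atTop := by
  obtain ⟨i, hi⟩ := h.adm.nonempty
  set H := ⨆ j : N, X.roundFreq 0 j with hH
  have hH1 : 1 ≤ H := (h.one_le_roundFreq 0 hi).trans (le_hull_sup hi)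
  refine tendsto_atTop_atTop_of_monotone h.run.time_mono fun b => ?_
  obtain ⟨q, hq⟩ := exists_nat_gt (2 * (H * b + 1))
  obtain ⟨k, hk⟩ := h.exists_lt_updates q
  refine ⟨k, ?_⟩
  have h1 := (h.lift_mem hphase k hi).2
  have h2 : (X.updates k i : ℝ) ≤ OscState.lift (X.updates k) (X.state k) i := by
    have := (h.inv k).coherent.timing.phase_nonneg i hi
    rw [OscState.lift, OscState.fires]
    push_cast
    linarith [(Nat.cast_nonneg ((X.state k).flag i).toNat : (0 : ℝ) ≤ _)]
  have h3 : (q : ℝ) < X.updates k i := by exact_mod_cast hk i hi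
  by_contra! hcon
  have h4 : H * X.time k ≤ H * b := mul_le_mul_of_nonneg_left hcon.le (by linarith)
  have h5 : 0 ≤ X.time k := h.run.time_zero ▸ h.run.time_mono (Nat.zero_le k)
  have h6 : 0 ≤ H * X.time k := mul_nonneg (by linarith) h5
  linarith

/-- At all times, the phases and the frequencies are exponentially close in the number of the
rounds of the slowest oscillator, which is at least proportional to the time. -/
theorem exists_bound [Fintype V] (h : X.IsRegular G N f α D)
    (hphase : ∀ i ∈ N, 0 ≤ (X.state 0).phase i ∧ (X.state 0).phase i < 1 / 2) :
    ∃ C ρ : ℝ, 0 ≤ C ∧ 0 < ρ ∧ ρ < 1 ∧ ∀ k, ∃ i ∈ N,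
      (X.state k).maxFreq N - (X.state k).minFreq N ≤ C * ρ ^ X.updates k i ∧
      ∀ s ∈ Set.Icc (X.time k) (X.time (k + 1)), s ≤ 5 / 4 * X.updates k i + 3 / 2 ∧
        ((X.state k).flow (s - X.time k)).arc N ≤ C * ρ ^ X.updates k i := by
  obtain ⟨C, ρ, hC, hρ0, hρ1, hb⟩ := h.exists_round_bound
  have hN := h.adm.nonempty
  set H := ⨆ j : N, X.roundFreq 0 j with hH
  have hH1 : 1 ≤ H := by
    obtain ⟨i, hi⟩ := hN
    exact (h.one_le_roundFreq 0 hi).trans (le_hull_sup hi)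
  have hHC : 0 ≤ H * C := mul_nonneg (by linarith) hC
  refine ⟨2 * (C + H * (3 * C)), ρ, by linarith, hρ0, hρ1, fun k => ?_⟩
  obtain ⟨i, hi, hslow⟩ := h.exists_slowest k
  obtain ⟨hb1, hb2⟩ := hb (X.updates k i)
  have hpow : 0 < ρ ^ X.updates k i := by positivity
  have hfreq : ∀ j ∈ N, (X.state k).freq j ∈ Set.Icc (⨅ j : N, X.roundFreq (X.updates k i) j)
      (⨆ j : N, X.roundFreq (X.updates k i) j) := fun j hj =>
    h.freq_mem_hull hj (by rcases hslow j hj with h | h <;> omega)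
  refine ⟨i, hi, ?_, fun s hs => ⟨?_, ?_⟩⟩
  · refine (width_le hN (fun j hj => (hfreq j hj).1) fun j hj => (hfreq j hj).2).trans
      (hb1.trans (mul_le_mul_of_nonneg_right ?_ hpow.le))
    linarith
  all_goals
    have hflow : (X.state k).CanFlow N (s - X.time k) := by
      refine ⟨sub_nonneg.2 hs.1, fun j hj => ?_⟩
      have h1 := (h.run.canFlow k).2 j hj
      have h2 : (s - X.time k) * (X.state k).freq j ≤
          (X.time (k + 1) - X.time k) * (X.state k).freq j :=
        mul_le_mul_of_nonneg_right (by linarith [hs.2])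
          (zero_le_one.trans ((h.inv k).coherent.timing.one_le_freq hj))
      exact ⟨by linarith [h1.1], fun a b => by linarith [h1.2 a b]⟩
    have hT := (h.inv k).coherent.timing.flow hflow
    rw [add_sub_cancel] at hT
  -- The lifted phase is at most `U + 3 / 2` and at least `s - U / 4`, whence `s ≤ 5 / 4 * U + 3 /
  -- 2`.
  · have h1 := hT.lift_le hi
    have h2 := (h.lift_mem hphase k hi).1
    have h3 : OscState.lift (X.updates k) ((X.state k).flow (s - X.time k)) i =
        OscState.lift (X.updates k) (X.state k) i + (s - X.time k) * (X.state k).freq i := by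
      simp only [OscState.lift, OscState.fires, OscState.flow]; ring
    have h4 := le_mul_of_one_le_right (sub_nonneg.2 hs.1)
      ((h.inv k).coherent.timing.one_le_freq hi)
    linarith
  · have hlo : ⨅ j : N, X.roundFreq (X.updates k i) j ≤ H :=
      (hull_inf_le hi).trans (h.roundFreq_mem_hull (Nat.zero_le _) i hi).2
    refine (hT.arc_le (G := G) (f := f) hN hslow hlo hfreq
      (fun j hj => h.time_step _ hj)).trans ?_
    have h1 : H * (width N (X.roundTime (X.updates k i)) +
        2 * width N (X.roundFreq (X.updates k i))) ≤ H * (3 * (C * ρ ^ X.updates k i)) :=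
      mul_le_mul_of_nonneg_left (by linarith) (by linarith)
    linarith

end IsRegular

/-- Exponential decay in the number of rounds is exponential decay in the number of events. -/
theorem exists_event_rate {K : ℕ} (hK : 1 ≤ K) {ρ : ℝ} (hρ0 : 0 < ρ) (hρ1 : ρ < 1) :
    ∃ r : ℝ, 0 < r ∧ r < 1 ∧ ∀ k q : ℕ, k / K ≤ q → ρ ^ q ≤ ρ⁻¹ * r ^ k := by
  have hK0 : K ≠ 0 := by omega
  set r : ℝ := ρ ^ ((K : ℝ)⁻¹) with hr
  have hrK : r ^ K = ρ := Real.rpow_inv_natCast_pow hρ0.le hK0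
  have hr0 : 0 < r := Real.rpow_pos_of_pos hρ0 _
  have hr1 : r < 1 := Real.rpow_lt_one hρ0.le hρ1 (by positivity)
  refine ⟨r, hr0, hr1, fun k q hq => ?_⟩
  have h1 : k ≤ K * (k / K + 1) := (Nat.lt_mul_div_succ k hK).le
  calc ρ ^ q ≤ ρ ^ (k / K) := pow_le_pow_of_le_one hρ0.le hρ1.le hq
    _ = ρ⁻¹ * ρ ^ (k / K + 1) := by rw [pow_succ]; field_simp
    _ = ρ⁻¹ * r ^ (K * (k / K + 1)) := by rw [pow_mul, hrK]
    _ ≤ ρ⁻¹ * r ^ k :=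
      mul_le_mul_of_nonneg_left (pow_le_pow_of_le_one hr0.le hr1.le h1) (inv_nonneg.2 hρ0.le)

/-- Exponential decay in the number of rounds is exponential decay in time. -/
theorem exists_time_rate {ρ : ℝ} (hρ0 : 0 < ρ) (hρ1 : ρ < 1) :
    ∃ C c : ℝ, 0 < C ∧ 0 < c ∧ ∀ (s : ℝ) (q : ℕ), s ≤ 5 / 4 * q + 3 / 2 →
      ρ ^ q ≤ C * Real.exp (-c * s) := by
  have hlog : Real.log ρ < 0 := Real.log_neg hρ0 hρ1
  -- The constants come from solving for `q`: `q ≥ 4 / 5 * s - 6 / 5`.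
  refine ⟨Real.exp (-(6 / 5) * Real.log ρ), -(4 / 5) * Real.log ρ, Real.exp_pos _, by linarith,
    fun s q hs => ?_⟩
  rw [← Real.exp_log (pow_pos hρ0 q), Real.log_pow, ← Real.exp_add, Real.exp_le_exp]
  nlinarith

end Execution

theorem theorem1 {V : Type*} [Fintype V] (G : Digraph V) (normal : Finset V) (f : ℕ) (α : ℝ)
    (hα : 0 < α)
    (hlocal : IsLocalAttack G normal f)
    (hrobust : IsRobust G (2 * f + 1))
    (X : Execution V)
    (hrun : X.IsRun G normal f α)
    (hstealthy : X.IsStealthy G normal)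
    (hphase : ∀ i ∈ normal, 0 ≤ (X.state 0).phase i ∧ (X.state 0).phase i < 1 / 2)
    (hfreq : ∀ i ∈ normal, 1 ≤ (X.state 0).freq i)
    (hinit : X.arc normal 0 +
      4 * (Fintype.card V : ℝ) * (normal.card : ℝ) / α ^ (2 * Fintype.card V * normal.card) *
        ((X.state 0).maxFreq normal - (X.state 0).minFreq normal) < 1 / 2) :
    -- time diverges, and all normal oscillators keep updating at a uniform pace
    Tendsto X.time atTop atTop ∧
    (∃ K : ℕ, 1 ≤ K ∧ K ≤ 3 * Fintype.card V ^ 2 ∧ X.UpdatesWithin normal K) ∧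
    -- the frequency spread tends to zero, at the stated geometric rate
    (∀ K : ℕ, 1 ≤ K → X.UpdatesWithin normal K →
      (∀ k : ℕ, X.spread normal K k ≤
        (1 - α ^ (K * normal.card) / 2) ^ (k / (K * normal.card)) * X.spread normal K 0) ∧
      Tendsto (X.spread normal K) atTop (𝓝 0)) ∧
    -- the normal containing arc tends to zero, exponentially in the number of events
    Tendsto (X.arc normal) atTop (𝓝 0) ∧
    (∃ C ρ : ℝ, 0 < ρ ∧ ρ < 1 ∧ ∀ k : ℕ, X.arc normal k ≤ C * ρ ^ k) ∧
    -- frequencies and phases synchronize exponentially in continuous time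
    (∃ C c : ℝ, 0 < c ∧ ∀ k : ℕ, ∀ s ∈ Set.Icc (X.time k) (X.time (k + 1)),
      (X.state k).maxFreq normal - (X.state k).minFreq normal ≤ C * Real.exp (-c * s) ∧
      ((X.state k).flow (s - X.time k)).arc normal ≤ C * Real.exp (-c * s)) := by
  have hN := hrun.nonempty
  have hα1 := hrun.le_one hstealthy hα.le
  have hcard : 1 ≤ Fintype.card V := hN.card_pos.trans_le normal.card_le_univ
  have hadm : OscState.Admissible G normal f α X.roundFreq (width normal (X.state 0).phase) := by
    refine ⟨hN, hrobust, hlocal, hα, hα1, ?_⟩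
    have h1 : width normal (X.state 0).phase ≤ X.arc normal 0 :=
      OscState.width_phase_le_arc hN hphase
    have h2 : width normal (X.roundFreq 0) =
        (X.state 0).maxFreq normal - (X.state 0).minFreq normal := by
      rw [Execution.roundFreq_zero]; rfl
    rw [← h2] at hinit
    -- The invariant needs only `1 / 2 + 2 * R / α ^ R`; the stated initial condition is much
    -- stronger.
    have h3 : 1 / 2 + 2 * (normal.card : ℝ) / α ^ normal.card ≤
        4 * (Fintype.card V : ℝ) * normal.card / α ^ (2 * Fintype.card V * normal.card) := by
      have hR : (1 : ℝ) ≤ normal.card := by exact_mod_cast hN.card_pos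
      have hV : (1 : ℝ) ≤ Fintype.card V := by exact_mod_cast hcard
      have hp1 : α ^ normal.card ≤ 1 := pow_le_one₀ hα.le hα1
      have hp2 : α ^ (2 * Fintype.card V * normal.card) ≤ α ^ normal.card :=
        pow_le_pow_of_le_one hα.le hα1 (Nat.le_mul_of_pos_left _ (by omega))
      have hp3 : 0 < α ^ (2 * Fintype.card V * normal.card) := by positivity
      have hp4 : 0 < α ^ normal.card := by positivity
      calc 1 / 2 + 2 * (normal.card : ℝ) / α ^ normal.card
          ≤ 4 * normal.card / α ^ normal.card := by
            rw [div_add_div _ _ two_ne_zero hp4.ne', div_le_div_iff₀ (by positivity) hp4]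
            nlinarith
        _ ≤ 4 * (Fintype.card V : ℝ) * normal.card /
            α ^ (2 * Fintype.card V * normal.card) := by
            refine div_le_div₀ (by positivity) ?_ hp3 hp2
            nlinarith
    have h4 := mul_le_mul_of_nonneg_right h3 (width_nonneg hN : 0 ≤ width normal (X.roundFreq 0))
    linarith
  have hreg : X.IsRegular G normal f α (width normal (X.state 0).phase) :=
    ⟨hrun, hstealthy, hadm, hrun.invariant hstealthy hadm hphase hfreq⟩
  have hK : 1 ≤ 3 * Fintype.card V ^ 2 := by
    have := Nat.pow_pos (n := 2) hcard
    omega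
  obtain ⟨C, ρ, hC, hρ0, hρ1, hb⟩ := hreg.exists_bound hphase
  obtain ⟨r, hr0, hr1, hr⟩ := Execution.exists_event_rate hK hρ0 hρ1
  have harc : ∀ k, X.arc normal k ≤ C * ρ⁻¹ * r ^ k := by
    intro k
    obtain ⟨i, hi, -, hs⟩ := hb k
    have h1 := (hs (X.time k) ⟨le_rfl, hrun.time_mono (Nat.le_succ k)⟩).2
    have h2 : (X.state k).flow (X.time k - X.time k) = X.state k := by
      simp [OscState.flow]
    rw [h2] at h1
    have h3 := hr k (X.updates k i)
      (hreg.updatesWithin.le_updates hi (Nat.div_mul_le_self k _))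
    calc X.arc normal k ≤ C * ρ ^ X.updates k i := h1
      _ ≤ C * (ρ⁻¹ * r ^ k) := mul_le_mul_of_nonneg_left h3 hC
      _ = C * ρ⁻¹ * r ^ k := by ring
  refine ⟨hreg.tendsto_time hphase, ⟨_, hK, le_rfl, hreg.updatesWithin⟩,
    fun K hK1 hup => ⟨hreg.spread_le hK1 hup, hreg.tendsto_spread hK1 hup⟩, ?_,
    ⟨C * ρ⁻¹, r, hr0, hr1, harc⟩, ?_⟩
  · refine squeeze_zero (fun k => OscState.arc_nonneg) harc ?_
    simpa using (tendsto_pow_atTop_nhds_zero_of_lt_one hr0.le hr1).const_mul (C * ρ⁻¹)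
  · obtain ⟨E, c, hE, hc, hrate⟩ := Execution.exists_time_rate hρ0 hρ1
    refine ⟨C * E, c, hc, fun k s hs => ?_⟩
    obtain ⟨i, hi, h1, h2⟩ := hb k
    obtain ⟨h3, h4⟩ := h2 s hs
    have h5 := mul_le_mul_of_nonneg_left (hrate s _ h3) hC
    rw [← mul_assoc] at h5
    exact ⟨h1.trans h5, h4.trans h5⟩
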